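/- Write $\omega(t)=\sqrt{1-t^2}$ on $(-1,1)$. For integers $0\le m\le n$ let $$Q_n^m=\Big(\tfrac{2n+1}{2}\,\tfrac{(n-m)!}{(n+m)!}\Big)^{1/2}\omega^m P_n^{(m)},\qquad P_n(t)=\frac{(-1)^n}{2^n n!}\frac{d^n}{dt^n}(1-t^2)^n$$ ($P_n^{(m)}$ is the $m$-th derivative of the Legendre polynomial $P_n$). For integers $m,k\ge 0$ put $$H_m^k=\Big\{u\in L^2(-1,1):\ \sum_{n\ge m}(2n+1)^{2k}\,|(u,Q_n^m)_{L^2(-1,1)}|^2<\infty\Big\},$$ $$X_m^k=\big\{u\in L^2(-1,1):\ \omega^{m+k}(\omega^{-m}u)^{(k)}\in L^2(-1,1)\big\},$$ with real-valued functions and derivatives in the sense of distributions on $(-1,1)$. Let $k\ge 0$ and $0\le m,m'\le k$ be integers. Then: (i) $H_{m'}^k\subseteq H_m^k$ if and only if $m'=k$ or $m'-m$ is a non-negative even integer. In particular, if $m'<k$, then $H_{m'}^k\subseteq H_m^k$ if and only if $m'-m$ is a non-negative even integer. (ii) The inclusion is strict exactly when, in addition, $m'\ne m$; that is, $H_{m'}^k\subsetneq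 H_m^k$ if and only if $m'\neq m$ and ($m'=k$ or $m'-m$ is a non-negative even integer). (iii) $\omega^{m'}\in X_m^k$ if and only if $m'=k$ or $m'-m$ is a non-negative even integer. -/

import Mathlib

open MeasureTheory Set

noncomputable section

namespace LegendreScale

/-- Lebesgue measure on the interval `(-1, 1)`. -/
def μI : Measure ℝ := volume.restrict (Ioo (-1 : ℝ) 1)

/-- The real Hilbert space `L²(-1, 1)`. -/
abbrev L2 : Type := Lp ℝ 2 μI

/-- The weight `ω(t) = √(1 - t²)`. -/
def omega (t : ℝ) : ℝ := Real.sqrt (1 - t ^ 2)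

/-- The Legendre polynomial `Pₙ = (-1)ⁿ / (2ⁿ n!) · dⁿ/dtⁿ (1 - t²)ⁿ`. -/
def legendreP (n : ℕ) : Polynomial ℝ :=
  Polynomial.C ((-1) ^ n / (2 ^ n * (n.factorial : ℝ))) *
    Polynomial.derivative^[n] ((1 - Polynomial.X ^ 2) ^ n)

/-- The associated Legendre function `Pₙᵐ(t) = (1 - t²)^{m/2} Pₙ⁽ᵐ⁾(t)`, for `m ≤ n`. -/
def assocLegendre (n m : ℕ) (t : ℝ) : ℝ :=
  omega t ^ m * (Polynomial.derivative^[m] (legendreP n)).eval t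

/-- The normalized function `Qₙᵐ = c_{n,m} Pₙᵐ`, where
`c_{n,m} = ((2n+1)/2 · (n-m)!/(n+m)!)^{1/2}`, for `m ≤ n`. -/
def Q (n m : ℕ) (t : ℝ) : ℝ :=
  Real.sqrt ((2 * n + 1) / 2 * (((n - m).factorial : ℝ) / ((n + m).factorial : ℝ))) * assocLegendre n m t

/-- The coefficient `(u, Qₙᵐ)_{L²(-1,1)}`. -/
def coeff (n m : ℕ) (u : L2) : ℝ := ∫ t, u t * Q n m t ∂μI

/-- The space `H_m^k` (`k` a non-negative integer) of the Hilbert scale generated by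
`{(Qₙᵐ; 2n+1) : n ≥ m}`: all `u ∈ L²(-1,1)` with `∑_{n ≥ m} (2n+1)^{2k} |(u, Qₙᵐ)|² < ∞`.
The index `n ≥ m` is written `n = m + j`. -/
def H (m k : ℕ) : Set L2 :=
  {u | Summable fun j : ℕ => (2 * ((m + j : ℕ) : ℝ) + 1) ^ (2 * k) * coeff (m + j) m u ^ 2}

/-- `g` is the `k`-th derivative of `f` in the sense of distributions on `(-1, 1)`, where `f` and
`g` are locally integrable there. -/
def IsWeakDeriv (k : ℕ) (f g : ℝ → ℝ) : Prop :=
  LocallyIntegrableOn f (Ioo (-1) 1) ∧ LocallyIntegrableOn g (Ioo (-1) 1) ∧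
    ∀ ψ : ℝ → ℝ, ContDiff ℝ ((⊤ : ℕ∞) : WithTop ℕ∞) ψ → HasCompactSupport ψ →
      tsupport ψ ⊆ Ioo (-1) 1 →
      ∫ t in Ioo (-1 : ℝ) 1, f t * iteratedDeriv k ψ t =
        (-1) ^ k * ∫ t in Ioo (-1 : ℝ) 1, g t * ψ t

/-- The weighted Sobolev space
`X_m^k = {u ∈ L²(-1,1) : ω^{m+k} (ω^{-m} u)^{(k)} ∈ L²(-1,1)}`, with the derivative in the sense of
distributions. -/
def X (m k : ℕ) : Set L2 :=
  {u | ∃ g : ℝ → ℝ, IsWeakDeriv k (fun t => (omega t ^ m)⁻¹ * u t) g ∧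
    MemLp (fun t => omega t ^ (m + k) * g t) 2 μI}

theorem memLp_omega_pow (m : ℕ) : MemLp (fun t => omega t ^ m) 2 μI := by
  have : IsFiniteMeasure μI := by
    unfold μI
    infer_instance
  have hc : Continuous fun t => omega t ^ m := by
    unfold omega
    fun_prop
  refine MemLp.of_bound hc.aestronglyMeasurable 1 (Filter.Eventually.of_forall fun t => ?_)
  have h0 : 0 ≤ omega t := Real.sqrt_nonneg _
  have h1 : omega t ≤ 1 := Real.sqrt_le_one.mpr (by nlinarith [sq_nonneg t])
  rw [Real.norm_of_nonneg (pow_nonneg h0 m)]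
  exact pow_le_one₀ h0 h1

/-- The function `ω^m` as an element of `L²(-1, 1)`. -/
def omegaPow (m : ℕ) : L2 := (memLp_omega_pow m).toLp _

end LegendreScale

end

/-! Differentiation is a ladder in the order $m$. With $Q_n^m=\omega^m q_{n,m}$ and
$\lambda_{n,s}=(n-s)(n+s+1)$ one has $q_{n,s}'=\sqrt{\lambda_{n,s}}\,q_{n,s+1}$, and the Legendre
equation gives the adjoint relation after integration by parts. Hence, for a polynomial $f$, the
function $\omega^{m+k}f^{(k)}$ has coefficients against $Q_n^{m+k}$ equal to those of $\omega^m f$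
against $Q_n^m$ times `kap n m k`, and `kap` squared is comparable to $(2n+1)^{2k}$ once $n\ge m+k$.
So the $H_m^k$ norm amounts to the $L^2$ norms of $u$ and $\omega^{m+k}(\omega^{-m}u)^{(k)}$.

Sufficiency. Since finite sums $\omega^{m'}p$ of the basis approximate $u\in H_{m'}^k$ with bounded
`energy`, an estimate on such sums is enough (`H_subset_of_estimate`). For $m'=m+2$,
$\omega^{m+2}p=\omega^m(Ep)$ with $E=1-t^2$, and Leibniz leaves three terms. For $m'=k$,
$\omega^{m+k}(\omega^{k-m}p)^{(k)}$ is a combination of the $E^jp^{(j)}$ with polynomial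
coefficients. In both cases the terms whose weight is too weak are controlled by `hardy`.

Necessity. $\omega^{m'}$ is a multiple of $Q_{m'}^{m'}$, so it lies in $H_{m'}^k$; if the inclusion
holds, it lies in $H_m^k\subseteq X_m^k$ (`H_subset_X`). But
$\omega^{m+k}(\omega^{m'-m})^{(k)}=\omega^{m'-k}r$ with a polynomial $r$, and $r(1)\ne0$ unless
$m'-m\in\{0,2,\dots,2k-2\}$. When $m'<k$ and $r(1)\ne 0$ this is not square integrable near $1$. -/

open scoped Polynomial

noncomputable section

namespace LegendreScale

/-! ### Legendre polynomials and their derivatives -/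

/-- The polynomial `1 - X²`. -/
def E : ℝ[X] := 1 - Polynomial.X ^ 2

@[simp] theorem eval_E (t : ℝ) : E.eval t = 1 - t ^ 2 := by simp [E]

@[simp] theorem derivative_E : Polynomial.derivative E = -2 * Polynomial.X := by
  simp [E]
  norm_num

theorem natDegree_E_pow (n : ℕ) : (E ^ n).natDegree = 2 * n := by
  have h : E.natDegree = 2 := by
    unfold E
    compute_degree!
  rw [Polynomial.natDegree_pow, h, mul_comm]

theorem leadingCoeff_E_pow (n : ℕ) : (E ^ n).leadingCoeff = (-1) ^ n := by
  have h : E.leadingCoeff = -1 := by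
    have h : E.natDegree = 2 := by
      unfold E
      compute_degree!
    rw [Polynomial.leadingCoeff, h, E]
    simp [Polynomial.coeff_one]
  rw [Polynomial.leadingCoeff_pow, h]

/-- The function $u=(1-t^2)^n$ satisfies $(1-t^2)u'+2ntu=0$; this is that equation differentiated
$N+1$ times. -/
theorem ode_E_pow (n N : ℕ) :
    E * Polynomial.derivative^[N + 2] (E ^ n)
      + Polynomial.C (2 * ((n : ℝ) - (N + 1))) * Polynomial.X *
        Polynomial.derivative^[N + 1] (E ^ n)
      + Polynomial.C (((N : ℝ) + 1) * (2 * n - N)) * Polynomial.derivative^[N] (E ^ n) = 0 := by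
  have h1 : E * Polynomial.derivative (E ^ n)
      + Polynomial.C (2 * (n : ℝ)) * Polynomial.X * E ^ n = 0 := by
    rcases n with _ | n
    · simp
    · simp only [Polynomial.derivative_pow, derivative_E]
      simp only [Nat.add_sub_cancel, map_mul, map_natCast, map_ofNat]
      ring
  induction N with
  | zero =>
    have := congrArg Polynomial.derivative h1
    simp only [Polynomial.derivative_add, Polynomial.derivative_mul, Polynomial.derivative_C,
      Polynomial.derivative_X, derivative_E, Polynomial.derivative_zero] at this
    simp only [Function.iterate_succ_apply', Function.iterate_zero, id]
    rw [← this]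
    simp only [map_mul, map_natCast, map_ofNat, map_sub, map_add, map_one, Nat.cast_zero, map_zero]
    ring
  | succ N ih =>
    have := congrArg Polynomial.derivative ih
    simp only [Polynomial.derivative_add, Polynomial.derivative_mul, Polynomial.derivative_C,
      Polynomial.derivative_X, derivative_E, Polynomial.derivative_zero,
      ← Function.iterate_succ_apply' (⇑(Polynomial.derivative (R := ℝ)))] at this
    rw [← this]
    simp only [Nat.succ_eq_add_one, map_mul, map_natCast, map_ofNat, map_sub, map_add, map_one,
      Nat.cast_add, Nat.cast_one]
    ring

theorem coeff_iterate_legendreP (n m : ℕ) (h : m ≤ n) :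
    (Polynomial.derivative^[m] (legendreP n)).coeff (n - m)
      = (2 * n).factorial / (2 ^ n * n.factorial * (n - m).factorial) := by
  rw [legendreP, Polynomial.iterate_derivative_C_mul, Polynomial.coeff_C_mul,
    ← Function.iterate_add_apply, Polynomial.coeff_iterate_derivative]
  have h1 : n - m + (m + n) = 2 * n := by omega
  have h2 := leadingCoeff_E_pow n
  rw [Polynomial.leadingCoeff, natDegree_E_pow] at h2
  have h3 : (((2 * n).descFactorial (m + n) : ℕ) : ℝ) = (2 * n).factorial / (n - m).factorial := by
    rw [eq_div_iff (by positivity), mul_comm]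
    have := Nat.factorial_mul_descFactorial (n := 2 * n) (k := m + n) (by omega)
    rw [show 2 * n - (m + n) = n - m by omega] at this
    exact_mod_cast this
  rw [h1]
  change _ * ((2 * n).descFactorial (m + n) • (E ^ n).coeff (2 * n)) = _
  rw [h2, nsmul_eq_mul, h3]
  have h4 : ((-1 : ℝ) ^ n) * (-1) ^ n = 1 := by rw [← mul_pow]; simp
  have : (-1 : ℝ) ^ n / (2 ^ n * n.factorial) * ((2 * n).factorial / (n - m).factorial * (-1) ^ n)
    = (((-1 : ℝ) ^ n) * (-1) ^ n) * ((2 * n).factorial / (2 ^ n * n.factorial * (n - m).factorial)) := by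
    field_simp
  rw [this, h4, one_mul]

theorem natDegree_iterate_legendreP_le (n m : ℕ) :
    (Polynomial.derivative^[m] (legendreP n)).natDegree ≤ n - m := by
  refine (Polynomial.natDegree_iterate_derivative _ _).trans ?_
  have : (legendreP n).natDegree ≤ n := by
    refine (Polynomial.natDegree_C_mul_le _ _).trans
      ((Polynomial.natDegree_iterate_derivative _ _).trans ?_)
    have := natDegree_E_pow n
    rw [E] at this
    omega
  omega

theorem iterate_legendreP_eq_zero {n m : ℕ} (h : n < m) :
    Polynomial.derivative^[m] (legendreP n) = 0 := by
  apply Polynomial.iterate_derivative_eq_zero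
  have := natDegree_iterate_legendreP_le n 0
  simp only [Function.iterate_zero, id] at this
  omega

/-- The eigenvalue `(n - s)(n + s + 1)`, which is `0` for `n ≤ s`. -/
def lam (n s : ℕ) : ℝ := ((n - s : ℕ) : ℝ) * (n + s + 1)

theorem lam_nonneg (n s : ℕ) : 0 ≤ lam n s := by unfold lam; positivity

theorem lam_of_le {n s : ℕ} (h : n ≤ s) : lam n s = 0 := by simp [lam, Nat.sub_eq_zero_of_le h]

theorem lam_pos {n s : ℕ} (h : s < n) : 0 < lam n s := by
  have : (0 : ℝ) < ((n - s : ℕ) : ℝ) := by exact_mod_cast Nat.sub_pos_of_lt h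
  unfold lam; positivity

/-- Rodrigues' formula turns this into `ode_E_pow` with $N=n+s$. For $n<s$ every term vanishes. -/
theorem legendre_ode (n s : ℕ) :
    E * Polynomial.derivative^[s + 2] (legendreP n)
      - Polynomial.C (2 * ((s : ℝ) + 1)) * Polynomial.X *
        Polynomial.derivative^[s + 1] (legendreP n)
      + Polynomial.C (lam n s) * Polynomial.derivative^[s] (legendreP n) = 0 := by
  rcases lt_or_ge n s with h | h
  · rw [iterate_legendreP_eq_zero h, iterate_legendreP_eq_zero (h.trans s.lt_succ_self),
      iterate_legendreP_eq_zero (m := s + 2) (by omega)]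
    simp
  · have := ode_E_pow n (n + s)
    simp only [legendreP, Polynomial.iterate_derivative_C_mul, ← Function.iterate_add_apply]
    rw [show s + 2 + n = n + s + 2 by ring, show s + 1 + n = n + s + 1 by ring, add_comm s n]
    rw [lam, Nat.cast_sub h]
    rw [E] at *
    simp only [map_mul, map_natCast, map_ofNat, map_sub, map_add, map_one, Nat.cast_add] at *
    linear_combination (Polynomial.C ((-1) ^ n / (2 ^ n * (n.factorial : ℝ)))) * this

/-- The normalizing constant of `Q n m`. -/
def cst (n m : ℕ) : ℝ :=
  Real.sqrt ((2 * n + 1) / 2 * (((n - m).factorial : ℝ) / ((n + m).factorial : ℝ)))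

theorem cst_pos (n m : ℕ) : 0 < cst n m := by unfold cst; positivity

/-- The polynomial factor of `Q n m`. -/
def q (n m : ℕ) : ℝ[X] := Polynomial.C (cst n m) * Polynomial.derivative^[m] (legendreP n)

theorem Q_eq (n m : ℕ) (t : ℝ) : Q n m t = omega t ^ m * (q n m).eval t := by
  simp only [Q, q, cst, assocLegendre, Polynomial.eval_mul, Polynomial.eval_C]
  ring

theorem q_eq_zero {n m : ℕ} (h : n < m) : q n m = 0 := by
  simp [q, iterate_legendreP_eq_zero h]

theorem cst_eq {n s : ℕ} (h : s < n) : cst n s = Real.sqrt (lam n s) * cst n (s + 1) := by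
  rw [cst, cst, ← Real.sqrt_mul (lam_nonneg n s), lam]
  congr 1
  obtain ⟨d, rfl⟩ := Nat.exists_eq_add_of_lt h
  rw [show s + d + 1 - s = d + 1 by omega, show s + d + 1 - (s + 1) = d by omega,
    ← add_assoc (s + d + 1), Nat.factorial_succ d, Nat.factorial_succ (s + d + 1 + s)]
  push_cast
  field_simp

theorem derivative_q (n s : ℕ) :
    Polynomial.derivative (q n s) = Polynomial.C (Real.sqrt (lam n s)) * q n (s + 1) := by
  rw [q, q, Polynomial.derivative_C_mul,
      ← Function.iterate_succ_apply' (⇑(Polynomial.derivative (R := ℝ))), Nat.succ_eq_add_one]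
  rcases lt_or_ge s n with h | h
  · rw [cst_eq h, Polynomial.C_mul, mul_assoc]
  · rw [iterate_legendreP_eq_zero (by omega)]
    simp

/-- The lowering counterpart of `derivative_q`: the Legendre equation divided by the common factor
$\sqrt{\lambda}$ in the normalization. It is what makes integration by parts close up on the family
`q`. -/
theorem q_ode (n s : ℕ) :
    E * Polynomial.derivative (q n (s + 1))
      - Polynomial.C (2 * ((s : ℝ) + 1)) * Polynomial.X * q n (s + 1)
      + Polynomial.C (Real.sqrt (lam n s)) * q n s = 0 := by
  rcases lt_or_ge s n with h | h
  · have h1 : cst n (s + 1) * lam n s = Real.sqrt (lam n s) * cst n s := by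
      rw [cst_eq h]
      nth_rewrite 1 [← Real.mul_self_sqrt (lam_nonneg n s)]
      ring
    have h2 := congrArg Polynomial.C h1
    have := legendre_ode n s
    rw [q, q, Polynomial.derivative_C_mul,
      ← Function.iterate_succ_apply' (⇑(Polynomial.derivative (R := ℝ))), Nat.succ_eq_add_one]
    simp only [map_mul] at h2
    linear_combination (Polynomial.C (cst n (s + 1))) * this
      - Polynomial.derivative^[s] (legendreP n) * h2
  · rw [q_eq_zero (m := s + 1) (by omega), lam_of_le h]
    simp

theorem degree_q (m j : ℕ) : (q (m + j) m).degree = j := by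
  rw [q, Polynomial.degree_C_mul (cst_pos _ _).ne']
  apply Polynomial.degree_eq_of_le_of_coeff_ne_zero
  · have := natDegree_iterate_legendreP_le (m + j) m
    rw [Nat.add_sub_cancel_left] at this
    exact Polynomial.degree_le_of_natDegree_le this
  · have := coeff_iterate_legendreP (m + j) m (by omega)
    rw [Nat.add_sub_cancel_left] at this
    rw [this]
    positivity

theorem q_self (n : ℕ) :
    q n n = Polynomial.C (cst n n * ((2 * n).factorial / (2 ^ n * n.factorial))) := by
  have h := natDegree_iterate_legendreP_le n n
  rw [Nat.sub_self] at h
  have h1 := coeff_iterate_legendreP n n le_rfl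
  rw [Nat.sub_self] at h1
  rw [q, Polynomial.eq_C_of_natDegree_le_zero h, h1, Polynomial.C_mul]
  simp

/-! ### Weighted integrals of polynomials -/

instance : IsFiniteMeasure μI := by
  unfold μI
  infer_instance

theorem continuous_omega : Continuous omega := by
  unfold omega
  fun_prop

theorem omega_nonneg (t : ℝ) : 0 ≤ omega t := Real.sqrt_nonneg _

theorem omega_le_one (t : ℝ) : omega t ≤ 1 :=
  Real.sqrt_le_one.mpr (by nlinarith [sq_nonneg t])

theorem omega_pos {t : ℝ} (h : t ∈ Ioo (-1 : ℝ) 1) : 0 < omega t :=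
  Real.sqrt_pos.mpr (by nlinarith [h.1, h.2])

theorem omega_sq {t : ℝ} (h : t ∈ Icc (-1 : ℝ) 1) : omega t ^ 2 = 1 - t ^ 2 :=
  Real.sq_sqrt (by nlinarith [h.1, h.2])

theorem ae_mem_Ioo : ∀ᵐ t ∂μI, t ∈ Ioo (-1 : ℝ) 1 := ae_restrict_mem measurableSet_Ioo

theorem memLp_of_continuous {f : ℝ → ℝ} (hf : Continuous f) (p : ENNReal) : MemLp f p μI := by
  obtain ⟨C, hC⟩ := isCompact_Icc.exists_bound_of_continuousOn (s := Icc (-1 : ℝ) 1)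
    hf.continuousOn
  refine MemLp.of_bound hf.aestronglyMeasurable C ?_
  filter_upwards [ae_mem_Ioo] with t ht using hC t (Ioo_subset_Icc_self ht)

theorem integrable_of_continuous {f : ℝ → ℝ} (hf : Continuous f) : Integrable f μI :=
  memLp_one_iff_integrable.mp (memLp_of_continuous hf 1)

theorem continuous_omega_mul (N : ℕ) (p : ℝ[X]) : Continuous fun t => omega t ^ N * p.eval t :=
  (continuous_omega.pow N).mul p.continuous

/-- The integral `∫ ω^N p` over `(-1, 1)`, as a functional on polynomials. -/
def wint (N : ℕ) : ℝ[X] →ₗ[ℝ] ℝ where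
  toFun p := ∫ t, omega t ^ N * p.eval t ∂μI
  map_add' p r := by
    rw [← integral_add (integrable_of_continuous (continuous_omega_mul N p))
      (integrable_of_continuous (continuous_omega_mul N r))]
    simp [mul_add]
  map_smul' c p := by
    simp only [Polynomial.eval_smul, smul_eq_mul, RingHom.id_apply, ← integral_const_mul]
    congr 1
    ext t
    ring

theorem wint_apply (N : ℕ) (p : ℝ[X]) : wint N p = ∫ t, omega t ^ N * p.eval t ∂μI := rfl

theorem wint_C_mul (N : ℕ) (c : ℝ) (p : ℝ[X]) : wint N (Polynomial.C c * p) = c * wint N p := by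
  rw [← Polynomial.smul_eq_C_mul, map_smul, smul_eq_mul]

theorem wint_congr {N M : ℕ} {p r : ℝ[X]}
    (h : ∀ t ∈ Ioo (-1 : ℝ) 1, omega t ^ N * p.eval t = omega t ^ M * r.eval t) :
    wint N p = wint M r := by
  apply integral_congr_ae
  filter_upwards [ae_mem_Ioo] with t ht using h t ht

theorem wint_add_two (N : ℕ) (p : ℝ[X]) : wint (N + 2) p = wint N (E * p) := by
  apply wint_congr
  intro t ht
  rw [pow_add, omega_sq (Ioo_subset_Icc_self ht), Polynomial.eval_mul, eval_E]
  ring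

theorem wint_mono {N M : ℕ} {p r : ℝ[X]}
    (h : ∀ t ∈ Ioo (-1 : ℝ) 1, omega t ^ N * p.eval t ≤ omega t ^ M * r.eval t) :
    wint N p ≤ wint M r := by
  apply integral_mono_ae (integrable_of_continuous (continuous_omega_mul N p))
      (integrable_of_continuous (continuous_omega_mul M r))
  filter_upwards [ae_mem_Ioo] with t ht using h t ht

theorem wint_sq_nonneg (N : ℕ) (p : ℝ[X]) : 0 ≤ wint N (p ^ 2) := by
  apply integral_nonneg
  intro t
  have := omega_nonneg t
  simp only [Polynomial.eval_pow]
  positivity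

theorem hasDerivAt_omega {t : ℝ} (h : t ∈ Ioo (-1 : ℝ) 1) :
    HasDerivAt omega (-t / omega t) t := by
  have h1 : HasDerivAt (fun t : ℝ => 1 - t ^ 2) (-(2 * t)) t := by
    simpa using (hasDerivAt_pow 2 t).const_sub 1
  have h2 : HasDerivAt omega (-(2 * t) / (2 * Real.sqrt (1 - t ^ 2))) t :=
    h1.sqrt (by nlinarith [h.1, h.2])
  convert h2 using 1
  rw [omega]
  ring

theorem integral_μI (f : ℝ → ℝ) : ∫ t, f t ∂μI = ∫ t in (-1 : ℝ)..1, f t := by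
  rw [intervalIntegral.integral_of_le (by norm_num), integral_Ioc_eq_integral_Ioo, μI]

/-- The fundamental theorem of calculus for `(ω^(N+2) g)'`. -/
theorem wint_derivative (N : ℕ) (g : ℝ[X]) :
    wint N (E * Polynomial.derivative g - Polynomial.C ((N : ℝ) + 2) * Polynomial.X * g) = 0 := by
  rw [wint_apply, integral_μI]
  rw [intervalIntegral.integral_eq_sub_of_hasDerivAt_of_le (by norm_num)
    (f := fun t => omega t ^ (N + 2) * g.eval t)]
  -- The boundary terms vanish because $\omega(\pm1)=0$ and the exponent $N+2$ is positive.
  · simp [omega]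
  · exact (continuous_omega_mul _ _).continuousOn
  · intro t ht
    refine (((hasDerivAt_omega ht).pow (N + 2)).mul (g.hasDerivAt t)).congr_deriv ?_
    have h0 := (omega_pos ht).ne'
    have h2 := omega_sq (Ioo_subset_Icc_self ht)
    simp only [Polynomial.eval_sub, Polynomial.eval_mul, Polynomial.eval_C, Polynomial.eval_X,
      eval_E, ← h2, Pi.pow_apply]
    rw [show N + 2 - 1 = N + 1 by omega]
    push_cast
    field_simp
    ring
  · exact (continuous_omega_mul _ _).intervalIntegrable _ _

/-- Integration by parts against the Legendre functions. -/
theorem wint_mul_q_succ (N n s : ℕ) (f : ℝ[X]) :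
    wint N ((E * Polynomial.derivative f
      - Polynomial.C ((N : ℝ) - 2 * s) * Polynomial.X * f) * q n (s + 1))
      = Real.sqrt (lam n s) * wint N (f * q n s) := by
  have h := wint_derivative N (f * q n (s + 1))
  rw [← wint_C_mul, ← sub_eq_zero, ← map_sub, ← h]
  congr 1
  have h1 := q_ode n s
  rw [Polynomial.derivative_mul]
  simp only [map_mul, map_natCast, map_ofNat, map_sub, map_add, map_one] at h1 ⊢
  linear_combination -f * h1

theorem wint_derivative_mul_q_succ (n s : ℕ) (f : ℝ[X]) :
    wint (2 * (s + 1)) (Polynomial.derivative f * q n (s + 1))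
      = Real.sqrt (lam n s) * wint (2 * s) (f * q n s) := by
  rw [← wint_mul_q_succ, mul_add, mul_one, wint_add_two]
  congr 1
  simp
  ring

/-! ### Orthonormality -/

theorem lam_injOn {n l s : ℕ} (hn : s ≤ n) (hl : s ≤ l) (h : lam n s = lam l s) : n = l := by
  rw [lam, lam, Nat.cast_sub hn, Nat.cast_sub hl] at h
  have h1 : ((n : ℝ) - l) * (n + l + 1) = 0 := by linarith
  rcases mul_eq_zero.mp h1 with h2 | h2
  · exact_mod_cast sub_eq_zero.mp h2
  · have : (0 : ℝ) < n + l + 1 := by positivity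
    linarith

theorem wint_q_mul_q_succ (n l s : ℕ) :
    Real.sqrt (lam l s) * wint (2 * (s + 1)) (q l (s + 1) * q n (s + 1))
      = Real.sqrt (lam n s) * wint (2 * s) (q l s * q n s) := by
  rw [← wint_derivative_mul_q_succ, derivative_q, mul_assoc, wint_C_mul]

/-- Self-adjointness: using `wint_q_mul_q_succ` with $n,l$ in both orders and eliminating the order
$s+1$ integral gives $(\lambda_{l,s}-\lambda_{n,s})\int=0$, and the eigenvalues are distinct. -/
theorem wint_q_mul_q_of_ne {n l s : ℕ} (hn : s ≤ n) (hl : s ≤ l) (h : l ≠ n) :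
    wint (2 * s) (q l s * q n s) = 0 := by
  by_contra h0
  have h1 := wint_q_mul_q_succ n l s
  have h2 := wint_q_mul_q_succ l n s
  rw [mul_comm (q n (s + 1)), mul_comm (q n s)] at h2
  apply h
  refine lam_injOn hl hn ?_
  have h3 := Real.mul_self_sqrt (lam_nonneg n s)
  have h4 := Real.mul_self_sqrt (lam_nonneg l s)
  have : (lam l s - lam n s) * wint (2 * s) (q l s * q n s) = 0 := by
    rw [← h3, ← h4]
    linear_combination Real.sqrt (lam n s) * h1 - Real.sqrt (lam l s) * h2
  rcases mul_eq_zero.mp this with h5 | h5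
  · exact sub_eq_zero.mp h5
  · exact absurd h5 h0

theorem wint_one_even (n : ℕ) :
    wint (2 * n) 1 = 2 * 4 ^ n * (n.factorial : ℝ) ^ 2 / (2 * n + 1).factorial := by
  induction n with
  | zero =>
    rw [wint_apply, integral_μI]
    norm_num
  | succ n ih =>
    have h1 : (2 * (n : ℝ) + 3) * wint (2 * (n + 1)) 1 = (2 * n + 2) * wint (2 * n) 1 := by
      have h := wint_derivative (2 * n) Polynomial.X
      rw [← sub_eq_zero, mul_add 2 n 1, mul_one, wint_add_two, ← wint_C_mul, ← wint_C_mul,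
        ← map_sub, ← h]
      congr 1
      simp only [E, Polynomial.derivative_X, map_add, map_mul, map_natCast, map_ofNat,
        Nat.cast_mul, Nat.cast_ofNat]
      ring
    rw [ih] at h1
    rw [eq_div_iff (by positivity)]
    rw [show 2 * (n + 1) + 1 = (2 * n + 1) + 1 + 1 by ring, Nat.factorial_succ (2 * n + 1 + 1),
      Nat.factorial_succ (2 * n + 1), Nat.factorial_succ n]
    rw [mul_div_assoc', eq_div_iff (by positivity)] at h1
    push_cast
    linear_combination (2 * (n : ℝ) + 2) * h1

theorem wint_q_self (n : ℕ) : wint (2 * n) (q n n * q n n) = 1 := by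
  rw [q_self, ← mul_one (Polynomial.C _), mul_assoc, wint_C_mul, one_mul, wint_C_mul,
    wint_one_even, Nat.factorial_succ]
  have h : cst n n * cst n n = (2 * n + 1) / 2 * (1 / (2 * n).factorial) := by
    rw [cst, Real.mul_self_sqrt (by positivity), Nat.sub_self, ← two_mul]
    simp
  have h4 : (4 : ℝ) ^ n = 2 ^ n * 2 ^ n := by rw [← mul_pow]; norm_num
  rw [← mul_assoc, mul_mul_mul_comm, h, h4]
  push_cast
  field_simp

/-- The ladder preserves the norm, so it descends from $s=n$, where `q n n` is constant and the
integral is explicit. -/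
theorem wint_q_mul_q_self {n s : ℕ} (h : s ≤ n) : wint (2 * s) (q n s * q n s) = 1 := by
  induction h using Nat.decreasingInduction with
  | self => exact wint_q_self n
  | of_succ s hs ih =>
    have h1 := wint_q_mul_q_succ n n s
    rw [ih] at h1
    exact (mul_left_cancel₀ (Real.sqrt_pos.mpr (lam_pos hs)).ne' h1).symm

/-! ### Weighted polynomials as elements of `L²` -/

/-- The function `ω^N p` as an element of `L²(-1, 1)`. -/
def wpoly (N : ℕ) (p : ℝ[X]) : L2 := (memLp_of_continuous (continuous_omega_mul N p) 2).toLp _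

theorem coeFn_wpoly (N : ℕ) (p : ℝ[X]) :
    (wpoly N p : ℝ → ℝ) =ᵐ[μI] fun t => omega t ^ N * p.eval t :=
  MemLp.coeFn_toLp _

theorem wpoly_add (N : ℕ) (p r : ℝ[X]) : wpoly N (p + r) = wpoly N p + wpoly N r := by
  rw [wpoly, wpoly, wpoly, ← MemLp.toLp_add]
  congr 1
  ext t
  simp [mul_add]

theorem wpoly_C_mul (N : ℕ) (c : ℝ) (p : ℝ[X]) :
    wpoly N (Polynomial.C c * p) = c • wpoly N p := by
  rw [wpoly, wpoly, ← MemLp.toLp_const_smul]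
  congr 1
  ext t
  simp
  ring

theorem wpoly_zero (N : ℕ) : wpoly N 0 = 0 := by simpa using wpoly_C_mul N 0 0

theorem wpoly_sum {ι : Type*} (N : ℕ) (s : Finset ι) (p : ι → ℝ[X]) :
    wpoly N (∑ i ∈ s, p i) = ∑ i ∈ s, wpoly N (p i) := by
  classical
  induction s using Finset.induction_on with
  | empty => simp [wpoly_zero]
  | insert a s ha ih => rw [Finset.sum_insert ha, Finset.sum_insert ha, wpoly_add, ih]

theorem inner_eq_integral {f : ℝ → ℝ} (hf : MemLp f 2 μI) (u : L2) :
    inner ℝ (hf.toLp f) u = ∫ t, u t * f t ∂μI := by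
  rw [L2.inner_def]
  apply integral_congr_ae
  filter_upwards [hf.coeFn_toLp] with t ht
  rw [ht]
  rfl

theorem inner_wpoly (N M : ℕ) (p r : ℝ[X]) :
    inner ℝ (wpoly N p) (wpoly M r) = wint (N + M) (p * r) := by
  rw [wpoly, inner_eq_integral, wint_apply]
  apply integral_congr_ae
  filter_upwards [coeFn_wpoly M r] with t ht
  rw [ht, Polynomial.eval_mul, pow_add]
  ring

theorem norm_wpoly_sq (N : ℕ) (p : ℝ[X]) : ‖wpoly N p‖ ^ 2 = wint (2 * N) (p ^ 2) := by
  rw [← real_inner_self_eq_norm_sq, inner_wpoly, two_mul, sq]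

theorem coeff_eq_inner (n m : ℕ) (u : L2) : coeff n m u = inner ℝ (wpoly m (q n m)) u := by
  rw [wpoly, inner_eq_integral, coeff]
  simp only [Q_eq]

theorem coeff_wpoly (n m N : ℕ) (p : ℝ[X]) :
    coeff n m (wpoly N p) = wint (N + m) (p * q n m) := by
  rw [coeff_eq_inner, real_inner_comm, inner_wpoly]

theorem orthonormal_wpoly_q (m : ℕ) : Orthonormal ℝ fun j : ℕ => wpoly m (q (m + j) m) := by
  rw [orthonormal_iff_ite]
  intro i j
  rw [inner_wpoly, ← two_mul]
  split_ifs with h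
  · rw [h, wint_q_mul_q_self (by omega)]
  · exact wint_q_mul_q_of_ne (by omega) (by omega) (by omega)

/-! ### Completeness -/

/-- By Weierstrass approximation on $[-1,1]$, vanishing against polynomials gives vanishing against
continuous functions. -/
theorem ae_eq_zero_of_integral_polynomial {f : ℝ → ℝ} (hf : Integrable f μI)
    (h : ∀ p : ℝ[X], ∫ t, f t * p.eval t ∂μI = 0) : f =ᵐ[μI] 0 := by
  have hc : ∀ g : ℝ → ℝ, Continuous g → ∫ t, f t * g t ∂μI = 0 := by
    intro g hg
    have hb : ∀ g : ℝ → ℝ, Continuous g → Integrable (fun t => f t * g t) μI := by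
      intro g hg
      obtain ⟨C, hC⟩ := isCompact_Icc.exists_bound_of_continuousOn (s := Icc (-1 : ℝ) 1)
        hg.continuousOn
      refine hf.mul_bdd (c := C) hg.aestronglyMeasurable ?_
      filter_upwards [ae_mem_Ioo] with t ht using hC t (Ioo_subset_Icc_self ht)
    have hε : ∀ ε > 0, |∫ t, f t * g t ∂μI| ≤ ε * ∫ t, |f t| ∂μI := by
      intro ε hε
      obtain ⟨p, hp⟩ := exists_polynomial_near_of_continuousOn (-1) 1 g hg.continuousOn ε hε
      have : ∫ t, f t * g t ∂μI = ∫ t, f t * (g t - p.eval t) ∂μI := by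
        simp only [mul_sub]
        rw [integral_sub (hb g hg) (hb _ p.continuous), h p, sub_zero]
      rw [this, ← integral_const_mul]
      refine abs_integral_le_integral_abs.trans ?_
      apply integral_mono_ae (hb _ (hg.sub p.continuous)).abs (hf.abs.const_mul ε)
      filter_upwards [ae_mem_Ioo] with t ht
      have := hp t (Ioo_subset_Icc_self ht)
      rw [abs_sub_comm] at this
      simp only [abs_mul]
      rw [mul_comm]
      gcongr
      exact this.le
    by_contra h0
    have hp : 0 < |∫ t, f t * g t ∂μI| := abs_pos.mpr h0
    have hn : 0 ≤ ∫ t, |f t| ∂μI := integral_nonneg fun t => abs_nonneg _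
    set A := ∫ t, |f t| ∂μI
    -- Any $\varepsilon$ with $\varepsilon A<|\int fg|$ contradicts `hε`; dividing by $A+1$ covers
    -- $A=0$.
    have := hε (|∫ t, f t * g t ∂μI| / (A + 1) / 2) (by positivity)
    have h2 : |∫ t, f t * g t ∂μI| / (A + 1) / 2 * A < |∫ t, f t * g t ∂μI| := by
      rw [div_div, div_mul_eq_mul_div, div_lt_iff₀ (by positivity)]
      nlinarith
    linarith
  refine ae_eq_zero_of_integral_contDiff_smul_eq_zero hf.locallyIntegrable ?_
  intro g hg _
  rw [← hc g hg.continuous]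
  simp [mul_comm]

/-- The polynomials `q (m + j) m`, of degree `j`. -/
def qSeq (m : ℕ) : Polynomial.Sequence ℝ := ⟨fun j => q (m + j) m, degree_q m⟩

theorem span_q (m : ℕ) : Submodule.span ℝ (Set.range fun j => q (m + j) m) = ⊤ := by
  refine (qSeq m).span fun i => ?_
  rw [isUnit_iff_ne_zero]
  exact Polynomial.leadingCoeff_ne_zero.mpr ((qSeq m).ne_zero i)

theorem eq_zero_of_coeff_eq_zero (m : ℕ) (u : L2) (h : ∀ j, coeff (m + j) m u = 0) : u = 0 := by
  have hp : ∀ p : ℝ[X], inner ℝ (wpoly m p) u = 0 := by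
    intro p
    have hp : p ∈ Submodule.span ℝ (Set.range fun j => q (m + j) m) := by simp [span_q]
    induction hp using Submodule.span_induction with
    | mem x hx =>
      obtain ⟨j, rfl⟩ := hx
      rw [← h j, coeff_eq_inner]
    | zero => rw [wpoly_zero, inner_zero_left]
    | add x y _ _ hx hy => rw [wpoly_add, inner_add_left, hx, hy, add_zero]
    | smul c x _ hx =>
      rw [Polynomial.smul_eq_C_mul, wpoly_C_mul, inner_smul_left, hx, mul_zero]
  have hi : Integrable (fun t => omega t ^ m * u t) μI :=
    (MemLp.integrable_mul (memLp_omega_pow m) (Lp.memLp u) :)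
  have h0 := ae_eq_zero_of_integral_polynomial hi fun p => by
    rw [← hp p, wpoly, inner_eq_integral]
    congr 1
    ext t
    ring
  rw [Lp.eq_zero_iff_ae_eq_zero]
  filter_upwards [h0, ae_mem_Ioo] with t ht ht1
  simpa [(omega_pos ht1).ne'] using ht

/-- The Hilbert basis `Q (m + j) m` of `L²(-1, 1)`. -/
def qBasis (m : ℕ) : HilbertBasis ℕ ℝ L2 :=
  HilbertBasis.mkOfOrthogonalEqBot (orthonormal_wpoly_q m) (by
    rw [Submodule.eq_bot_iff]
    intro u hu
    apply eq_zero_of_coeff_eq_zero m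
    intro j
    rw [coeff_eq_inner]
    exact (Submodule.mem_orthogonal _ _).mp hu _ (Submodule.subset_span ⟨j, rfl⟩))

theorem hasSum_coeff_smul (m : ℕ) (u : L2) :
    HasSum (fun j => coeff (m + j) m u • wpoly m (q (m + j) m)) u := by
  have h := (qBasis m).hasSum_repr u
  simp only [HilbertBasis.repr_apply_apply] at h
  simpa [qBasis, coeff_eq_inner] using h

/-! ### Iterated derivatives of the Legendre functions -/

/-- The factor in `(q n m)⁽ⁱ⁾ = kap n m i * q n (m + i)`. -/
def kap (n m i : ℕ) : ℝ := ∏ l ∈ Finset.range i, Real.sqrt (lam n (m + l))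

theorem kap_succ (n m i : ℕ) : kap n m (i + 1) = kap n m i * Real.sqrt (lam n (m + i)) :=
  Finset.prod_range_succ _ _

theorem kap_sq (n m i : ℕ) : kap n m i ^ 2 = ∏ l ∈ Finset.range i, lam n (m + l) := by
  rw [kap, ← Finset.prod_pow]
  exact Finset.prod_congr rfl fun l _ => Real.sq_sqrt (lam_nonneg _ _)

theorem kap_sq_le (n m i : ℕ) : kap n m i ^ 2 ≤ (2 * (n : ℝ) + 1) ^ (2 * i) := by
  rw [kap_sq, pow_mul]
  have : ((2 * (n : ℝ) + 1) ^ 2) ^ i = ∏ l ∈ Finset.range i, ((2 * (n : ℝ) + 1) ^ 2) := by simp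
  rw [this]
  refine Finset.prod_le_prod (fun l _ => lam_nonneg _ _) fun l _ => ?_
  rcases lt_or_ge (m + l) n with h | h
  · have h1 : ((m + l : ℕ) : ℝ) ≤ n := by exact_mod_cast h.le
    have h2 : ((n - (m + l) : ℕ) : ℝ) ≤ n := by exact_mod_cast Nat.sub_le _ _
    rw [lam, sq]
    gcongr <;> linarith [Nat.cast_nonneg (α := ℝ) n]
  · rw [lam_of_le h]
    positivity

/-- The bound is factorwise. As $n-(m+l)\ge1$, one power of $2n+1$ is at most $(2(m+i)+1)(n-m-l)$
and the other at most $2(n+m+l+1)$. For $m\le n<m+i$ it would fail, since `kap` is then $0$. -/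
theorem le_kap_sq {n m i : ℕ} (h : m + i ≤ n) :
    (2 * (n : ℝ) + 1) ^ (2 * i) ≤ (2 * (2 * (m + i : ℕ) + 1)) ^ i * kap n m i ^ 2 := by
  have : (2 * (2 * ((m + i : ℕ) : ℝ) + 1)) ^ i
      = ∏ l ∈ Finset.range i, (2 * (2 * ((m + i : ℕ) : ℝ) + 1)) := by simp
  rw [kap_sq, this, ← Finset.prod_mul_distrib, pow_mul]
  have : ((2 * (n : ℝ) + 1) ^ 2) ^ i = ∏ l ∈ Finset.range i, ((2 * (n : ℝ) + 1) ^ 2) := by simp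
  rw [this]
  refine Finset.prod_le_prod (fun l _ => by positivity) fun l hl => ?_
  have hl := Finset.mem_range.mp hl
  obtain ⟨d, rfl⟩ := Nat.exists_eq_add_of_le h
  obtain ⟨e, rfl⟩ := Nat.exists_eq_add_of_lt hl
  rw [lam, show m + (l + e + 1) + d - (m + l) = e + 1 + d by omega]
  push_cast
  have h1 : 2 * ((m : ℝ) + (l + e + 1) + d) + 1 ≤ (2 * (m + (l + e + 1)) + 1) * (e + 1 + d) := by
    have hm := Nat.cast_nonneg (α := ℝ) m
    have hl := Nat.cast_nonneg (α := ℝ) l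
    have he := Nat.cast_nonneg (α := ℝ) e
    have hd := Nat.cast_nonneg (α := ℝ) d
    have : 0 ≤ (2 * ((m : ℝ) + (l + e + 1)) - 1) * d + (2 * (m + (l + e + 1)) + 1) * e := by
      apply add_nonneg
      · exact mul_nonneg (by linarith) hd
      · positivity
    linarith
  have h2 : 2 * ((m : ℝ) + (l + e + 1) + d) + 1 ≤ 2 * (m + (l + e + 1) + d + (m + l) + 1) := by
    linarith [Nat.cast_nonneg (α := ℝ) m, Nat.cast_nonneg (α := ℝ) l]
  calc _ = (2 * ((m : ℝ) + (l + e + 1) + d) + 1) * (2 * ((m : ℝ) + (l + e + 1) + d) + 1) := sq _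
    _ ≤ ((2 * (m + (l + e + 1)) + 1) * (e + 1 + d)) * (2 * (m + (l + e + 1) + d + (m + l) + 1)) := by
      gcongr
    _ = _ := by ring

theorem iterate_derivative_q (n m i : ℕ) :
    Polynomial.derivative^[i] (q n m) = Polynomial.C (kap n m i) * q n (m + i) := by
  induction i with
  | zero => simp [kap]
  | succ i ih =>
    rw [Function.iterate_succ_apply', ih, Polynomial.derivative_C_mul, derivative_q, kap_succ,
      Polynomial.C_mul, mul_assoc, add_assoc]

theorem wint_iterate_derivative_mul_q (n m i : ℕ) (f : ℝ[X]) :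
    wint (2 * (m + i)) (Polynomial.derivative^[i] f * q n (m + i))
      = kap n m i * wint (2 * m) (f * q n m) := by
  induction i with
  | zero => simp [kap]
  | succ i ih =>
    rw [Function.iterate_succ_apply', ← add_assoc m i 1, wint_derivative_mul_q_succ, ih, kap_succ]
    ring

/-- The polynomials with `(ω^c p)⁽ⁱ⁾ = ω^(c-2i) * rseq c p i`. -/
def rseq (c : ℝ) (p : ℝ[X]) : ℕ → ℝ[X]
  | 0 => p
  | i + 1 => E * Polynomial.derivative (rseq c p i)
      - Polynomial.C (c - 2 * i) * Polynomial.X * rseq c p i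

/-- The weight stays $\omega^{k+m}$ for all $i$: each derivative of $\omega^{k-m}p$ costs
$\omega^{-2}$, and raising the order in both factors $\omega^{m+i}$ restores it. -/
theorem wint_rseq_mul_q (n m k i : ℕ) (p : ℝ[X]) :
    wint (k + m) (rseq (k - m) p i * q n (m + i)) = kap n m i * wint (k + m) (p * q n m) := by
  induction i with
  | zero => simp [kap, rseq]
  | succ i ih =>
    have h := wint_mul_q_succ (k + m) n (m + i) (rseq (k - m) p i)
    have e : ((k + m : ℕ) : ℝ) - 2 * ((m + i : ℕ) : ℝ) = k - m - 2 * i := by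
      push_cast
      ring
    rw [ih, e] at h
    rw [rseq, ← add_assoc m i 1, h, kap_succ]
    ring

/-! ### Hardy inequalities -/

/-- The right side minus the left is $\int\omega^{2r}\big((1-t^2)g'-(r+1)tg\big)^2$, once the cross
term is integrated by parts. -/
theorem hardy (r : ℕ) (g : ℝ[X]) :
    ((r : ℝ) + 1) ^ 2 * wint (2 * r) (g ^ 2) ≤ wint (2 * r + 4) (Polynomial.derivative g ^ 2)
      + ((r + 1) ^ 2 + (r + 1)) * wint (2 * r + 2) (g ^ 2) := by
  have h := wint_derivative (2 * r) (Polynomial.X * g ^ 2)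
  have h1 : ((r : ℝ) + 1) ^ 2 * wint (2 * r) (g ^ 2) =
      wint (2 * r) (Polynomial.C (((r : ℝ) + 1) ^ 2) * g ^ 2 + Polynomial.C ((r : ℝ) + 1) *
      (E * Polynomial.derivative (Polynomial.X * g ^ 2)
        - Polynomial.C (((2 * r : ℕ) : ℝ) + 2) * Polynomial.X * (Polynomial.X * g ^ 2))) := by
    rw [map_add, wint_C_mul, wint_C_mul, h, mul_zero, add_zero]
  rw [h1, ← wint_C_mul, show 2 * r + 4 = 2 * r + 2 + 2 by ring, wint_add_two (2 * r + 2),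
    wint_add_two (2 * r), wint_add_two (2 * r), ← map_add]
  apply wint_mono
  intro t ht
  apply mul_le_mul_of_nonneg_left _ (pow_nonneg (omega_nonneg t) _)
  simp only [Polynomial.eval_add, Polynomial.eval_mul, Polynomial.eval_sub, Polynomial.eval_C,
    Polynomial.eval_X, Polynomial.derivative_mul, Polynomial.derivative_X, Polynomial.eval_pow,
    Polynomial.derivative_pow, eval_E, Polynomial.eval_one, Nat.cast_mul, Nat.cast_ofNat,
    Nat.reduceSub, pow_one]
  nlinarith [sq_nonneg ((1 - t ^ 2) * (Polynomial.derivative g).eval t - (r + 1) * t * g.eval t)]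

/-- Pointwise in $x=1-t^2$: where $x\le1/4$ the extra factor $x$ gives the first term, elsewhere
$(4x)^M\ge1$ gives the second. This lets the lower-order term of `hardy` be absorbed. -/
theorem wint_interpolate (a M : ℕ) (g : ℝ[X]) :
    wint (2 * a + 2) (g ^ 2) ≤ 1 / 4 * wint (2 * a) (g ^ 2) + 4 ^ M * wint (2 * M) (g ^ 2) := by
  rw [← wint_C_mul, ← wint_C_mul]
  have h : wint (2 * M) (Polynomial.C (4 ^ M) * g ^ 2)
      = wint 0 (E ^ M * (Polynomial.C (4 ^ M) * g ^ 2)) := wint_congr fun t ht => by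
    rw [pow_mul, omega_sq (Ioo_subset_Icc_self ht), pow_zero, Polynomial.eval_mul (p := E ^ M)]
    simp
  have h1 : wint (2 * a) (Polynomial.C (1 / 4) * g ^ 2)
      = wint 0 (E ^ a * (Polynomial.C (1 / 4) * g ^ 2)) := wint_congr fun t ht => by
    rw [pow_mul, omega_sq (Ioo_subset_Icc_self ht), pow_zero, Polynomial.eval_mul (p := E ^ a)]
    simp
  rw [h, h1, ← map_add]
  apply wint_mono
  intro t ht
  rw [show 2 * a + 2 = 2 * (a + 1) by ring, pow_mul, omega_sq (Ioo_subset_Icc_self ht)]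
  simp only [Polynomial.eval_add, Polynomial.eval_mul, Polynomial.eval_C, Polynomial.eval_pow,
    eval_E, pow_zero, one_mul]
  have h0 : 0 ≤ 1 - t ^ 2 := by nlinarith [ht.1, ht.2]
  have h1 : 1 - t ^ 2 ≤ 1 := by nlinarith [sq_nonneg t]
  set x := 1 - t ^ 2
  have key : x ^ (a + 1) ≤ x ^ a * (1 / 4) + x ^ M * 4 ^ M := by
    rcases le_or_gt x (1 / 4) with hx | hx
    · rw [pow_succ]
      have : x ^ a * x ≤ x ^ a * (1 / 4) := by gcongr
      have : 0 ≤ x ^ M * 4 ^ M := by positivity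
      linarith
    · have h2 : x ^ (a + 1) ≤ 1 := pow_le_one₀ h0 h1
      have h3 : 1 ≤ (x * 4) ^ M := one_le_pow₀ (by linarith)
      rw [mul_pow] at h3
      have : 0 ≤ x ^ a * (1 / 4) := by positivity
      linarith
  calc _ ≤ (x ^ a * (1 / 4) + x ^ M * 4 ^ M) * g.eval t ^ 2 := by gcongr
    _ = _ := by ring

/-- The squared norm of `H m k` up to constants, for `u = ω^m p`. -/
def energy (m k : ℕ) (p : ℝ[X]) : ℝ :=
  ∑ i ∈ Finset.range (k + 1), wint (2 * (m + i)) ((Polynomial.derivative^[i] p) ^ 2)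

theorem le_energy {m k i : ℕ} (h : i ≤ k) (p : ℝ[X]) :
    wint (2 * (m + i)) ((Polynomial.derivative^[i] p) ^ 2) ≤ energy m k p :=
  Finset.single_le_sum
    (f := fun i => wint (2 * (m + i)) ((Polynomial.derivative^[i] p) ^ 2))
    (fun _ _ => wint_sq_nonneg _ _) (Finset.mem_range.mpr (by omega))

theorem energy_nonneg (m k : ℕ) (p : ℝ[X]) : 0 ≤ energy m k p :=
  Finset.sum_nonneg fun _ _ => wint_sq_nonneg _ _

/-- Descent from $j=k$, where $4j=2(k+j)$ and the integral is a term of `energy`. Each step down is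
`hardy` with $r=2j$. -/
theorem exists_wint_four_mul_le {k j : ℕ} (h : j ≤ k) : ∃ C : ℝ, 0 ≤ C ∧ ∀ p : ℝ[X],
    wint (2 * (2 * j)) ((Polynomial.derivative^[j] p) ^ 2) ≤ C * energy k k p := by
  induction h using Nat.decreasingInduction with
  | self =>
    refine ⟨1, zero_le_one, fun p => ?_⟩
    rw [one_mul, two_mul k]
    exact le_energy le_rfl p
  | of_succ j hj ih =>
    obtain ⟨C, hC, ih⟩ := ih
    refine ⟨2 * C + 4 * 4 ^ (k + j), by positivity, fun p => ?_⟩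
    have h1 := hardy (2 * j) (Polynomial.derivative^[j] p)
    have h2 := wint_interpolate (2 * j) (k + j) (Polynomial.derivative^[j] p)
    have h3 := ih p
    have h4 := le_energy (m := k) hj.le p
    rw [← Function.iterate_succ_apply' (⇑(Polynomial.derivative (R := ℝ))),
      show 2 * (2 * j) + 4 = 2 * (2 * (j + 1)) by ring] at h1
    have h5 := wint_sq_nonneg (2 * (2 * j)) (Polynomial.derivative^[j] p)
    have h6 := wint_sq_nonneg (2 * (2 * (j + 1))) (Polynomial.derivative^[j + 1] p)
    have h7 := wint_sq_nonneg (2 * (k + j)) (Polynomial.derivative^[j] p)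
    set x := wint (2 * (2 * j)) (Polynomial.derivative^[j] p ^ 2)
    set y := wint (2 * (2 * (j + 1))) (Polynomial.derivative^[j + 1] p ^ 2)
    set z := wint (2 * (k + j)) (Polynomial.derivative^[j] p ^ 2)
    set e := energy k k p
    set s : ℝ := ((2 * j : ℕ) : ℝ) + 1 with hs
    have hs1 : 1 ≤ s := by rw [hs]; linarith [Nat.cast_nonneg (α := ℝ) (2 * j)]
    have h8 : s ^ 2 * x ≤ y + 2 * s ^ 2 * (1 / 4 * x + 4 ^ (k + j) * z) := by
      refine h1.trans ?_
      have : s ^ 2 + s ≤ 2 * s ^ 2 := by nlinarith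
      have : (s ^ 2 + s) * wint (2 * (2 * j) + 2) (Polynomial.derivative^[j] p ^ 2)
          ≤ 2 * s ^ 2 * (1 / 4 * x + 4 ^ (k + j) * z) :=
        mul_le_mul this h2 (wint_sq_nonneg _ _) (by positivity)
      simpa using this
    have h9 : y ≤ s ^ 2 * y := le_mul_of_one_le_left h6 (one_le_pow₀ hs1)
    have h10 : x ≤ y + 2 * (1 / 4 * x + 4 ^ (k + j) * z) :=
      -- After division by $s^2$ the term $x/2$ on the right is absorbed, giving the constant
      -- $2C+4\cdot4^{k+j}$.
      le_of_mul_le_mul_left (a := s ^ 2) (by linarith) (by positivity)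
    have h11 : (4 : ℝ) ^ (k + j) * z ≤ 4 ^ (k + j) * e := by gcongr
    linarith

/-! ### Norm estimates on weighted polynomials -/

/-- In the recursion a derivative always comes with a factor $E$, so $p^{(j)}$ carries $E^j$. The
coefficients do not depend on $p$, which makes later constants uniform. -/
theorem rseq_eq_sum (c : ℝ) (i : ℕ) : ∃ a : ℕ → ℝ[X], ∀ p : ℝ[X],
    rseq c p i = ∑ j ∈ Finset.range (i + 1), a j * (E ^ j * Polynomial.derivative^[j] p) := by
  induction i with
  | zero => exact ⟨fun _ => 1, fun p => by simp [rseq]⟩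
  | succ i ih =>
    obtain ⟨a, ha⟩ := ih
    let b : ℕ → ℝ[X] := fun j => if j ≤ i then E * Polynomial.derivative (a j)
      - Polynomial.C (2 * (j : ℝ)) * Polynomial.X * a j
      - Polynomial.C (c - 2 * i) * Polynomial.X * a j else 0
    -- `b` collects the terms where no new derivative hits $p$; `d` collects those where one does,
    -- with the index shifted.
    let d : ℕ → ℝ[X] := fun j => if j = 0 then 0 else a (j - 1)
    refine ⟨fun j => b j + d j, fun p => ?_⟩
    rw [rseq, ha]
    have hb : ∑ j ∈ Finset.range (i + 1 + 1), b j * (E ^ j * Polynomial.derivative^[j] p)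
        = ∑ j ∈ Finset.range (i + 1), (E * Polynomial.derivative (a j)
      - Polynomial.C (2 * (j : ℝ)) * Polynomial.X * a j
      - Polynomial.C (c - 2 * i) * Polynomial.X * a j) *
        (E ^ j * Polynomial.derivative^[j] p) := by
      rw [Finset.sum_range_succ]
      have : b (i + 1) = 0 := by simp [b]
      rw [this, zero_mul, add_zero]
      refine Finset.sum_congr rfl fun j hj => ?_
      have : j ≤ i := Nat.lt_succ_iff.mp (Finset.mem_range.mp hj)
      simp only [b, this, if_true]
    have hd : ∑ j ∈ Finset.range (i + 1 + 1), d j * (E ^ j * Polynomial.derivative^[j] p)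
        = ∑ j ∈ Finset.range (i + 1), a j *
          (E ^ (j + 1) * Polynomial.derivative^[j + 1] p) := by
      rw [Finset.sum_range_succ']
      simp [d]
    simp only [add_mul]
    rw [Finset.sum_add_distrib, hb, hd, Polynomial.derivative_sum, Finset.mul_sum, Finset.mul_sum,
      ← Finset.sum_sub_distrib, ← Finset.sum_add_distrib]
    refine Finset.sum_congr rfl fun j _ => ?_
    rw [Function.iterate_succ_apply' (⇑(Polynomial.derivative (R := ℝ)))]
    have : E * Polynomial.derivative (E ^ j)
        = - Polynomial.C (2 * (j : ℝ)) * Polynomial.X * E ^ j := by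
      rcases j with _ | j
      · simp
      · simp only [Polynomial.derivative_pow, derivative_E, Nat.add_sub_cancel, map_mul,
          map_natCast, map_ofNat]
        ring
    simp only [Polynomial.derivative_mul]
    linear_combination (a j * Polynomial.derivative^[j] p) * this

theorem exists_wint_mul_sq_le (a : ℝ[X]) : ∃ C : ℝ, 0 ≤ C ∧ ∀ (N : ℕ) (g : ℝ[X]),
    wint N ((a * g) ^ 2) ≤ C * wint N (g ^ 2) := by
  obtain ⟨C, hC⟩ := isCompact_Icc.exists_bound_of_continuousOn (s := Icc (-1 : ℝ) 1)
    a.continuous.continuousOn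
  refine ⟨C ^ 2, sq_nonneg C, fun N g => ?_⟩
  rw [← wint_C_mul]
  apply wint_mono
  intro t ht
  apply mul_le_mul_of_nonneg_left _ (pow_nonneg (omega_nonneg t) _)
  simp only [Polynomial.eval_mul, Polynomial.eval_pow, Polynomial.eval_C, mul_pow]
  have := hC t (Ioo_subset_Icc_self ht)
  rw [Real.norm_eq_abs] at this
  have := sq_le_sq' (by linarith [neg_abs_le (a.eval t)]) ((le_abs_self _).trans this)
  gcongr

theorem wint_sum_sq_le {ι : Type*} (N : ℕ) (s : Finset ι) (f : ι → ℝ[X]) :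
    wint N ((∑ j ∈ s, f j) ^ 2) ≤ s.card * ∑ j ∈ s, wint N (f j ^ 2) := by
  rw [← map_sum, ← wint_C_mul]
  apply wint_mono
  intro t _
  apply mul_le_mul_of_nonneg_left _ (pow_nonneg (omega_nonneg t) _)
  simp only [Polynomial.eval_mul, Polynomial.eval_pow, Polynomial.eval_C,
    Polynomial.eval_finsetSum]
  exact sq_sum_le_card_mul_sum_sq

theorem wint_E_pow_mul_sq (N j : ℕ) (g : ℝ[X]) :
    wint N ((E ^ j * g) ^ 2) = wint (N + 2 * (2 * j)) (g ^ 2) := by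
  apply wint_congr
  intro t ht
  rw [pow_add, pow_mul _ 2 (2 * j), omega_sq (Ioo_subset_Icc_self ht)]
  simp only [Polynomial.eval_mul, Polynomial.eval_pow, eval_E]
  ring

theorem exists_wint_rseq_sq_le (c : ℝ) (k : ℕ) : ∃ C : ℝ, 0 ≤ C ∧ ∀ p : ℝ[X],
    wint 0 (rseq c p k ^ 2) ≤ C * energy k k p := by
  obtain ⟨a, ha⟩ := rseq_eq_sum c k
  choose C hC0 hC using fun j => exists_wint_mul_sq_le (a j)
  have h4 : ∀ j, ∃ D : ℝ, 0 ≤ D ∧ (j ≤ k → ∀ p : ℝ[X],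
      wint (2 * (2 * j)) ((Polynomial.derivative^[j] p) ^ 2) ≤ D * energy k k p) := by
    intro j
    by_cases h : j ≤ k
    · obtain ⟨D, h1, h2⟩ := exists_wint_four_mul_le h
      exact ⟨D, h1, fun _ => h2⟩
    · exact ⟨0, le_rfl, fun h' => absurd h' h⟩
  choose D hD0 hD using h4
  refine ⟨(Finset.range (k + 1)).card * ∑ j ∈ Finset.range (k + 1), C j * D j,
    mul_nonneg (Nat.cast_nonneg _) (Finset.sum_nonneg fun j _ => mul_nonneg (hC0 j) (hD0 j)),
    fun p => ?_⟩
  rw [ha, mul_assoc, Finset.sum_mul]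
  refine (wint_sum_sq_le _ _ _).trans ?_
  gcongr with j hj
  refine (hC j _ _).trans ?_
  rw [mul_assoc, wint_E_pow_mul_sq, zero_add]
  exact mul_le_mul_of_nonneg_left (hD j (Nat.lt_succ_iff.mp (Finset.mem_range.mp hj)) p) (hC0 j)

theorem iterate_derivative_E_mul (l : ℕ) (p : ℝ[X]) :
    Polynomial.derivative^[l + 2] (E * p) = E * Polynomial.derivative^[l + 2] p
      - Polynomial.C (2 * ((l : ℝ) + 2)) * Polynomial.X * Polynomial.derivative^[l + 1] p
      - Polynomial.C (((l : ℝ) + 2) * (l + 1)) * Polynomial.derivative^[l] p := by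
  induction l with
  | zero =>
    simp only [Function.iterate_succ_apply', Function.iterate_zero, id, Polynomial.derivative_mul,
      derivative_E, Polynomial.derivative_X, map_mul, map_ofNat,
      Polynomial.derivative_neg, Polynomial.derivative_ofNat, map_add, Nat.cast_zero, map_zero,
      map_one]
    ring
  | succ l ih =>
    rw [show l + 1 + 2 = (l + 2) + 1 by ring, Function.iterate_succ_apply' _ (l + 2) (E * p), ih]
    simp only [Polynomial.derivative_mul, Polynomial.derivative_sub, Polynomial.derivative_C,
      derivative_E, Polynomial.derivative_X,
      ← Function.iterate_succ_apply' (⇑(Polynomial.derivative (R := ℝ)))]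
    simp only [Nat.succ_eq_add_one, map_mul, map_natCast, map_ofNat, map_add, map_one,
      Nat.cast_add, Nat.cast_one]
    ring

/-- Of the three Leibniz terms, the outer two already have the weights occurring in `energy (m + 2)
(l + 2)`. The middle one lacks a factor $\omega^2$, supplied by `hardy` with $r=m+l+2$. -/
theorem exists_wint_iterate_derivative_E_mul_sq_le (m l : ℕ) : ∃ C : ℝ, 0 ≤ C ∧ ∀ p : ℝ[X],
    wint (2 * (m + (l + 2))) ((Polynomial.derivative^[l + 2] (E * p)) ^ 2)
      ≤ C * energy (m + 2) (l + 2) p := by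
  set A : ℝ := (2 * ((l : ℝ) + 2)) ^ 2
  set B : ℝ := (((l : ℝ) + 2) * (l + 1)) ^ 2
  refine ⟨3 * (1 + A * (1 + 2) + B), by positivity, fun p => ?_⟩
  have h0 := le_energy (m := m + 2) (le_refl (l + 2)) p
  have h1 := le_energy (m := m + 2) (show l + 1 ≤ l + 2 by omega) p
  have h2 := le_energy (m := m + 2) (show l ≤ l + 2 by omega) p
  have h3 := hardy (m + (l + 2)) (Polynomial.derivative^[l + 1] p)
  rw [← Function.iterate_succ_apply' (⇑(Polynomial.derivative (R := ℝ))), Nat.succ_eq_add_one,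
    show 2 * (m + (l + 2)) + 4 = 2 * (m + 2 + (l + 2)) by ring,
    show 2 * (m + (l + 2)) + 2 = 2 * (m + 2 + (l + 1)) by ring] at h3
  have h4 : wint (2 * (m + (l + 2))) ((Polynomial.derivative^[l + 2] (E * p)) ^ 2)
      ≤ 3 * (wint (2 * (m + 2 + (l + 2))) ((Polynomial.derivative^[l + 2] p) ^ 2)
        + A * wint (2 * (m + (l + 2))) ((Polynomial.derivative^[l + 1] p) ^ 2)
        + B * wint (2 * (m + 2 + l)) ((Polynomial.derivative^[l] p) ^ 2)) := by
    rw [show 2 * (m + 2 + (l + 2)) = 2 * (m + (l + 2)) + 2 * (2 * 1) by ring, ← wint_E_pow_mul_sq,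
      pow_one, show 2 * (m + 2 + l) = 2 * (m + (l + 2)) by ring, ← wint_C_mul, ← wint_C_mul,
      ← map_add, ← map_add, ← wint_C_mul, iterate_derivative_E_mul]
    apply wint_mono
    intro t ht
    apply mul_le_mul_of_nonneg_left _ (pow_nonneg (omega_nonneg t) _)
    simp only [Polynomial.eval_add, Polynomial.eval_mul, Polynomial.eval_sub, Polynomial.eval_C,
      Polynomial.eval_X, Polynomial.eval_pow, eval_E, A, B]
    set a := (1 - t ^ 2) * (Polynomial.derivative^[l + 2] p).eval t
    set b := 2 * ((l : ℝ) + 2) * (Polynomial.derivative^[l + 1] p).eval t with hb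
    set c := ((l : ℝ) + 2) * (l + 1) * (Polynomial.derivative^[l] p).eval t with hc
    have ht1 : t ^ 2 ≤ 1 := by nlinarith [ht.1, ht.2]
    have : (t * b) ^ 2 ≤ b ^ 2 := by
      rw [mul_pow]
      exact mul_le_of_le_one_left (sq_nonneg b) ht1
    have e1 : 2 * ((l : ℝ) + 2) * t * (Polynomial.derivative^[l + 1] p).eval t = t * b := by
      rw [hb]; ring
    rw [← mul_pow, ← hb, ← mul_pow, e1]
    nlinarith [sq_nonneg (a + t * b), sq_nonneg (a + c), sq_nonneg (t * b - c)]
  have h5 : wint (2 * (m + (l + 2))) ((Polynomial.derivative^[l + 1] p) ^ 2)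
      ≤ (1 + 2) * energy (m + 2) (l + 2) p := by
    set s : ℝ := ((m + (l + 2) : ℕ) : ℝ) + 1 with hs
    have hs1 : 1 ≤ s := by rw [hs]; linarith [Nat.cast_nonneg (α := ℝ) (m + (l + 2))]
    have he := energy_nonneg (m + 2) (l + 2) p
    refine le_of_mul_le_mul_left (a := s ^ 2) (h3.trans ?_) (by positivity)
    have hA : energy (m + 2) (l + 2) p ≤ s ^ 2 * energy (m + 2) (l + 2) p :=
      le_mul_of_one_le_left he (one_le_pow₀ hs1)
    have hB : (s ^ 2 + s) * wint (2 * (m + 2 + (l + 1))) ((Polynomial.derivative^[l + 1] p) ^ 2)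
        ≤ (2 * s ^ 2) * energy (m + 2) (l + 2) p :=
      mul_le_mul (by nlinarith) h1 (wint_sq_nonneg _ _) (by positivity)
    linarith
  refine h4.trans ?_
  have hA : 0 ≤ A := sq_nonneg _
  have hB : 0 ≤ B := sq_nonneg _
  nlinarith [mul_le_mul_of_nonneg_left h5 hA, mul_le_mul_of_nonneg_left h2 hB]

/-! ### Inclusions between the spaces `H m k` -/

theorem inner_wpoly_q_of_ne {n l s : ℕ} (h : n ≠ l) :
    inner ℝ (wpoly s (q n s)) (wpoly s (q l s)) = 0 := by
  rcases lt_or_ge n s with hn | hn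
  · rw [q_eq_zero hn, wpoly_zero, inner_zero_left]
  rcases lt_or_ge l s with hl | hl
  · rw [q_eq_zero hl, wpoly_zero, inner_zero_right]
  rw [inner_wpoly, ← two_mul]
  exact wint_q_mul_q_of_ne hl hn h

theorem inner_wpoly_q_self_le (n s : ℕ) :
    inner ℝ (wpoly s (q n s)) (wpoly s (q n s)) ≤ (1 : ℝ) := by
  rcases lt_or_ge n s with hn | hn
  · rw [q_eq_zero hn, wpoly_zero, inner_zero_left]
    exact zero_le_one
  · rw [inner_wpoly, ← two_mul, wint_q_mul_q_self hn]

theorem norm_sum_smul_q_sq_le (m s : ℕ) (F : Finset ℕ) (c : ℕ → ℝ) :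
    ‖∑ j ∈ F, c j • wpoly s (q (m + j) s)‖ ^ 2 ≤ ∑ j ∈ F, c j ^ 2 := by
  rw [← real_inner_self_eq_norm_sq, sum_inner]
  refine Finset.sum_le_sum fun j hj => ?_
  rw [inner_sum, Finset.sum_eq_single j]
  · rw [inner_smul_left, inner_smul_right]
    have := inner_wpoly_q_self_le (m + j) s
    have h2 := sq_nonneg (c j)
    simp only [conj_trivial]
    nlinarith
  · intro l _ hl
    rw [inner_smul_left, inner_smul_right, inner_wpoly_q_of_ne (by omega)]
    simp
  · exact fun h => absurd hj h

theorem sum_coeff_sq_le (m s : ℕ) (F : Finset ℕ) (u : L2) :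
    ∑ j ∈ F, coeff (m + j) s u ^ 2 ≤ ‖u‖ ^ 2 := by
  have h1 := norm_sum_smul_q_sq_le m s F fun j => coeff (m + j) s u
  have h2 : inner ℝ (∑ j ∈ F, coeff (m + j) s u • wpoly s (q (m + j) s)) u
      = ∑ j ∈ F, coeff (m + j) s u ^ 2 := by
    rw [sum_inner]
    refine Finset.sum_congr rfl fun j _ => ?_
    rw [inner_smul_left, ← coeff_eq_inner, sq]
    rfl
  have h3 := real_inner_le_norm (∑ j ∈ F, coeff (m + j) s u • wpoly s (q (m + j) s)) u
  rw [h2] at h3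
  set S := ∑ j ∈ F, coeff (m + j) s u ^ 2
  set y := ‖∑ j ∈ F, coeff (m + j) s u • wpoly s (q (m + j) s)‖
  nlinarith [sq_nonneg (y - ‖u‖)]

/-- Here $w$ stands for $\omega^{m+k}(\omega^{-m}u)^{(k)}$. The terms $j<k$, on which `kap`
vanishes, have bounded weight and are charged to $u$; the others are charged to $w$ through
`le_kap_sq`. Bessel's inequality finishes. -/
theorem sum_pow_mul_coeff_sq_le {m k : ℕ} {u w : L2}
    (h : ∀ n, m ≤ n → coeff n (m + k) w = kap n m k * coeff n m u) (F : Finset ℕ) :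
    ∑ j ∈ F, (2 * ((m + j : ℕ) : ℝ) + 1) ^ (2 * k) * coeff (m + j) m u ^ 2
      ≤ (2 * (2 * (m + k : ℕ) + 1)) ^ (2 * k) * (‖u‖ ^ 2 + ‖w‖ ^ 2) := by
  set C : ℝ := (2 * (2 * (m + k : ℕ) + 1)) ^ (2 * k) with hC
  have hC0 : 0 ≤ C := by positivity
  calc _ ≤ ∑ j ∈ F, C * (coeff (m + j) m u ^ 2 + coeff (m + j) (m + k) w ^ 2) := by
        refine Finset.sum_le_sum fun j _ => ?_
        rcases lt_or_ge j k with hj | hj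
        · have h1 : (2 * ((m + j : ℕ) : ℝ) + 1) ^ (2 * k) ≤ C := by
            have : ((m + j : ℕ) : ℝ) ≤ (m + k : ℕ) := by exact_mod_cast (by omega)
            rw [hC]
            gcongr
            linarith [Nat.cast_nonneg (α := ℝ) (m + j)]
          have h2 := sq_nonneg (coeff (m + j) (m + k) w)
          have h3 := sq_nonneg (coeff (m + j) m u)
          nlinarith [mul_nonneg hC0 h2, mul_le_mul_of_nonneg_right h1 h3]
        · rw [h _ (by omega), mul_pow]
          have h1 := le_kap_sq (n := m + j) (m := m) (i := k) (by omega)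
          have h2 : (2 * (2 * ((m + k : ℕ) : ℝ) + 1)) ^ k ≤ C :=
            pow_le_pow_right₀ (by linarith [Nat.cast_nonneg (α := ℝ) (m + k)]) (by omega)
          have h3 := sq_nonneg (coeff (m + j) m u)
          have h4 := h1.trans (mul_le_mul_of_nonneg_right h2 (sq_nonneg _))
          nlinarith [mul_nonneg hC0 h3, mul_le_mul_of_nonneg_right h4 h3]
    _ ≤ _ := by
        rw [← Finset.mul_sum, Finset.sum_add_distrib]
        gcongr
        · exact sum_coeff_sq_le m m F u
        · exact sum_coeff_sq_le m (m + k) F w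

theorem tendsto_sum_coeff (m : ℕ) (u : L2) : Filter.Tendsto
    (fun N => wpoly m (∑ j ∈ Finset.range N, Polynomial.C (coeff (m + j) m u) * q (m + j) m))
    Filter.atTop (nhds u) := by
  have := (hasSum_coeff_smul m u).tendsto_sum_nat
  simpa only [wpoly_sum, wpoly_C_mul] using this

theorem wpoly_iterate_derivative_sum (m i N : ℕ) (c : ℕ → ℝ) :
    wpoly (m + i) (Polynomial.derivative^[i]
        (∑ j ∈ Finset.range N, Polynomial.C (c j) * q (m + j) m))
      = ∑ j ∈ Finset.range N, (c j * kap (m + j) m i) • wpoly (m + i) (q (m + j) (m + i)) := by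
  rw [Polynomial.iterate_derivative_sum, wpoly_sum]
  refine Finset.sum_congr rfl fun j _ => ?_
  rw [Polynomial.iterate_derivative_C_mul, iterate_derivative_q, ← mul_assoc, ← Polynomial.C_mul,
    wpoly_C_mul]

theorem wint_iterate_derivative_sum_sq_le {i k : ℕ} (h : i ≤ k) (m N : ℕ) (c : ℕ → ℝ) :
    wint (2 * (m + i)) ((Polynomial.derivative^[i]
        (∑ j ∈ Finset.range N, Polynomial.C (c j) * q (m + j) m)) ^ 2)
      ≤ ∑ j ∈ Finset.range N, (2 * ((m + j : ℕ) : ℝ) + 1) ^ (2 * k) * c j ^ 2 := by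
  rw [← norm_wpoly_sq, wpoly_iterate_derivative_sum]
  refine (norm_sum_smul_q_sq_le _ _ _ _).trans (Finset.sum_le_sum fun j _ => ?_)
  rw [mul_pow, mul_comm]
  have h1 := (kap_sq_le (m + j) m i).trans (pow_le_pow_right₀
    (by linarith [Nat.cast_nonneg (α := ℝ) (m + j)]) (show 2 * i ≤ 2 * k by omega))
  gcongr

theorem continuous_coeff (n m : ℕ) : Continuous (coeff n m) := by
  have : coeff n m = fun u => inner ℝ (wpoly m (q n m)) u := funext fun u => coeff_eq_inner n m u
  rw [this]
  fun_prop

/-- An inclusion of the spaces `H` follows from an estimate on weighted polynomials. -/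
theorem H_subset_of_estimate {m m' k : ℕ} {C : ℝ} (hC : 0 ≤ C)
    (h : ∀ p : ℝ[X], ∃ w : L2,
      (∀ n, m ≤ n → coeff n (m + k) w = kap n m k * coeff n m (wpoly m' p)) ∧
      ‖w‖ ^ 2 ≤ C * energy m' k p) : H m' k ⊆ H m k := by
  intro u hu
  have hu' : Summable fun j : ℕ => (2 * ((m' + j : ℕ) : ℝ) + 1) ^ (2 * k) * coeff (m' + j) m' u ^ 2 :=
    hu
  set S := ∑' j : ℕ, (2 * ((m' + j : ℕ) : ℝ) + 1) ^ (2 * k) * coeff (m' + j) m' u ^ 2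
  set p : ℕ → ℝ[X] := fun N =>
    ∑ j ∈ Finset.range N, Polynomial.C (coeff (m' + j) m' u) * q (m' + j) m' with hp
  have hE : ∀ N, ∀ i ≤ k, wint (2 * (m' + i)) ((Polynomial.derivative^[i] (p N)) ^ 2) ≤ S :=
    fun N i hi => (wint_iterate_derivative_sum_sq_le hi m' N _).trans
      (hu'.sum_le_tsum _ fun j _ => by positivity)
  have hE' : ∀ N, energy m' k (p N) ≤ (k + 1) * S := fun N => by
    refine (Finset.sum_le_sum fun i hi =>
      hE N i (Nat.lt_succ_iff.mp (Finset.mem_range.mp hi))).trans_eq ?_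
    simp
  have key : ∀ F : Finset ℕ, ∀ N,
      ∑ j ∈ F, (2 * ((m + j : ℕ) : ℝ) + 1) ^ (2 * k) * coeff (m + j) m (wpoly m' (p N)) ^ 2
      ≤ (2 * (2 * (m + k : ℕ) + 1)) ^ (2 * k) * (S + C * ((k + 1) * S)) := by
    intro F N
    obtain ⟨w, hw1, hw2⟩ := h (p N)
    refine (sum_pow_mul_coeff_sq_le hw1 F).trans ?_
    gcongr
    · rw [norm_wpoly_sq]
      exact hE N 0 (Nat.zero_le _)
    · exact hw2.trans (mul_le_mul_of_nonneg_left (hE' N) hC)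
  have ht : ∀ F : Finset ℕ, Filter.Tendsto (fun N => ∑ j ∈ F, (2 * ((m + j : ℕ) : ℝ) + 1) ^ (2 * k) *
      coeff (m + j) m (wpoly m' (p N)) ^ 2) Filter.atTop
      (nhds (∑ j ∈ F, (2 * ((m + j : ℕ) : ℝ) + 1) ^ (2 * k) * coeff (m + j) m u ^ 2)) :=
    fun F => tendsto_finsetSum _ fun j _ =>
      ((((continuous_coeff _ _).tendsto u).comp (tendsto_sum_coeff m' u)).pow 2).const_mul _
  -- For a fixed finite `F` only finitely many continuous coefficients occur, so the bound, uniform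
  -- in `N` and `F`, survives the limit in `N`.
  exact summable_of_sum_le (fun j => by positivity) fun F => le_of_tendsto' (ht F) (key F)

theorem H_add_two_subset {m k : ℕ} (h : m + 2 ≤ k) : H (m + 2) k ⊆ H m k := by
  obtain ⟨l, rfl⟩ : ∃ l, k = l + 2 := ⟨k - 2, by omega⟩
  obtain ⟨C, hC, hCp⟩ := exists_wint_iterate_derivative_E_mul_sq_le m l
  refine H_subset_of_estimate hC fun p =>
    ⟨wpoly (m + (l + 2)) (Polynomial.derivative^[l + 2] (E * p)), fun n _ => ?_, ?_⟩
  · rw [coeff_wpoly, ← two_mul, wint_iterate_derivative_mul_q, coeff_wpoly, mul_assoc,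
      ← wint_add_two, show 2 * m + 2 = m + 2 + m by ring]
  · rw [norm_wpoly_sq]
    exact hCp p

theorem H_add_two_mul_subset {m j k : ℕ} (h : m + 2 * j ≤ k) : H (m + 2 * j) k ⊆ H m k := by
  induction j with
  | zero => exact subset_rfl
  | succ j ih =>
    exact (H_add_two_subset (m := m + 2 * j) (by omega)).trans (ih (by omega))

theorem H_self_subset (m k : ℕ) : H k k ⊆ H m k := by
  obtain ⟨C, hC, hCp⟩ := exists_wint_rseq_sq_le ((k : ℝ) - m) k
  refine H_subset_of_estimate hC fun p => ⟨wpoly 0 (rseq (k - m) p k), fun n _ => ?_, ?_⟩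
  · rw [coeff_wpoly, coeff_wpoly, ← wint_rseq_mul_q, zero_add, add_comm m k]
  · rw [norm_wpoly_sq]
    exact hCp p

/-! ### Weak derivatives -/

/-- Test functions on `(-1, 1)`. -/
structure IsTest (ψ : ℝ → ℝ) : Prop where
  contDiff : ContDiff ℝ ((⊤ : ℕ∞) : WithTop ℕ∞) ψ
  hasCompactSupport : HasCompactSupport ψ
  tsupport_subset : tsupport ψ ⊆ Ioo (-1) 1

theorem IsTest.deriv {ψ : ℝ → ℝ} (h : IsTest ψ) : IsTest (deriv ψ) :=
  ⟨(contDiff_infty_iff_deriv.mp h.contDiff).2, h.hasCompactSupport.deriv,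
    tsupport_deriv_subset.trans h.tsupport_subset⟩

theorem IsTest.iteratedDeriv {ψ : ℝ → ℝ} (h : IsTest ψ) (k : ℕ) : IsTest (iteratedDeriv k ψ) := by
  induction k with
  | zero => simpa using h
  | succ k ih =>
    rw [iteratedDeriv_succ]
    exact ih.deriv

theorem IsTest.continuous_mul {f ψ : ℝ → ℝ} (h : IsTest ψ) (hf : ContinuousOn f (Ioo (-1) 1)) :
    Continuous fun t => f t * ψ t :=
  (hf.mul h.contDiff.continuous.continuousOn).continuous_of_tsupport_subset isOpen_Ioo
    (tsupport_mul_subset_right.trans h.tsupport_subset)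

theorem IsTest.integrable_mul {f ψ : ℝ → ℝ} (h : IsTest ψ) (hf : ContinuousOn f (Ioo (-1) 1)) :
    Integrable fun t => f t * ψ t :=
  (h.continuous_mul hf).integrable_of_hasCompactSupport h.hasCompactSupport.mul_left

theorem IsTest.integrable_mul_of_locallyIntegrableOn {f ψ : ℝ → ℝ} (h : IsTest ψ)
    (hf : LocallyIntegrableOn f (Ioo (-1) 1)) : Integrable fun t => f t * ψ t := by
  have h1 := hf.integrableOn_compact_subset h.tsupport_subset h.hasCompactSupport
  have h2 : IntegrableOn (fun t => f t * ψ t) (tsupport ψ) :=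
    h1.mul_continuousOn h.contDiff.continuous.continuousOn h.hasCompactSupport
  rwa [integrableOn_iff_integrable_of_support_subset] at h2
  exact (Function.support_mul_subset_right _ _).trans (subset_tsupport ψ)

theorem IsTest.setIntegral_mul {ψ : ℝ → ℝ} (h : IsTest ψ) (f : ℝ → ℝ) :
    ∫ t in Ioo (-1 : ℝ) 1, f t * ψ t = ∫ t, f t * ψ t := by
  apply setIntegral_eq_integral_of_forall_compl_eq_zero
  intro t ht
  rw [image_eq_zero_of_notMem_tsupport fun h' => ht (h.tsupport_subset h'), mul_zero]

theorem integral_mul_iteratedDeriv {F : ℕ → ℝ → ℝ}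
    (hF : ∀ i, ∀ t ∈ Ioo (-1 : ℝ) 1, HasDerivAt (F i) (F (i + 1) t) t) (k : ℕ) {ψ : ℝ → ℝ}
    (h : IsTest ψ) : ∫ t, F 0 t * iteratedDeriv k ψ t = (-1) ^ k * ∫ t, F k t * ψ t := by
  have hc : ∀ i, ContinuousOn (F i) (Ioo (-1) 1) := fun i t ht =>
    (hF i t ht).continuousAt.continuousWithinAt
  induction k generalizing F with
  | zero => simp
  | succ k ih =>
    have h1 := h.iteratedDeriv k
    have h2 : ∫ t, F 0 t * iteratedDeriv (k + 1) ψ t = - ∫ t, F 1 t * iteratedDeriv k ψ t := by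
      rw [iteratedDeriv_succ]
      exact integral_mul_deriv_eq_deriv_mul_of_integrable (fun t ht => hF 0 t (h1.tsupport_subset ht))
        (fun t _ => (h1.contDiff.differentiable (by simp) t).hasDerivAt)
        (h1.deriv.integrable_mul (hc 0)) (h1.integrable_mul (hc 1)) (h1.integrable_mul (hc 0))
    rw [h2, ih (F := fun i => F (i + 1)) (fun i => hF (i + 1)) (fun i => hc (i + 1)), pow_succ]
    ring

theorem isWeakDeriv_of_hasDerivAt {F : ℕ → ℝ → ℝ}
    (hF : ∀ i, ∀ t ∈ Ioo (-1 : ℝ) 1, HasDerivAt (F i) (F (i + 1) t) t) (k : ℕ) :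
    IsWeakDeriv k (F 0) (F k) := by
  have hc : ∀ i, LocallyIntegrableOn (F i) (Ioo (-1) 1) := fun i =>
    ContinuousOn.locallyIntegrableOn
      (fun t ht => (hF i t ht).continuousAt.continuousWithinAt) measurableSet_Ioo
  refine ⟨hc 0, hc k, fun ψ h1 h2 h3 => ?_⟩
  have h : IsTest ψ := ⟨h1, h2, h3⟩
  rw [(h.iteratedDeriv k).setIntegral_mul, h.setIntegral_mul, integral_mul_iteratedDeriv hF k h]

theorem IsWeakDeriv.congr_left {k : ℕ} {f f' g : ℝ → ℝ} (h : IsWeakDeriv k f g)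
    (hf : f =ᵐ[μI] f') : IsWeakDeriv k f' g := by
  refine ⟨h.1.congr hf, h.2.1, fun ψ h1 h2 h3 => ?_⟩
  rw [← h.2.2 ψ h1 h2 h3]
  apply integral_congr_ae
  filter_upwards [hf] with t ht
  rw [ht]

theorem IsWeakDeriv.ae_eq {k : ℕ} {f g g' : ℝ → ℝ} (h : IsWeakDeriv k f g)
    (h' : IsWeakDeriv k f g') : g =ᵐ[μI] g' := by
  have h0 := isOpen_Ioo.ae_eq_zero_of_integral_contDiff_smul_eq_zero (h.2.1.sub h'.2.1)
    fun ψ h1 h2 h3 => by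
      have hψ : IsTest ψ := ⟨h1, h2, h3⟩
      have e := (h.2.2 ψ h1 h2 h3).symm.trans (h'.2.2 ψ h1 h2 h3)
      rw [hψ.setIntegral_mul, hψ.setIntegral_mul] at e
      have e' := mul_left_cancel₀ (pow_ne_zero k (by norm_num)) e
      rw [← sub_eq_zero, ← integral_sub (hψ.integrable_mul_of_locallyIntegrableOn h.2.1)
        (hψ.integrable_mul_of_locallyIntegrableOn h'.2.1)] at e'
      rw [← e']
      congr 1
      ext t
      simp only [smul_eq_mul, Pi.sub_apply]
      ring
  filter_upwards [ae_restrict_of_ae h0, ae_mem_Ioo] with t ht ht1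
  exact sub_eq_zero.mp (ht ht1)

theorem isWeakDeriv_polynomial (k : ℕ) (p : ℝ[X]) :
    IsWeakDeriv k (fun t => p.eval t) (fun t => (Polynomial.derivative^[k] p).eval t) :=
  isWeakDeriv_of_hasDerivAt (F := fun i t => (Polynomial.derivative^[i] p).eval t)
    (fun i t _ => by
      simp only [Function.iterate_succ_apply']
      exact Polynomial.hasDerivAt _ _) k

theorem isWeakDeriv_omega_zpow (k : ℕ) (c : ℤ) :
    IsWeakDeriv k (fun t => omega t ^ c)
      (fun t => omega t ^ (c - 2 * k) * (rseq c 1 k).eval t) := by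
  have h := isWeakDeriv_of_hasDerivAt
    (F := fun i t => omega t ^ (c - 2 * i) * (rseq c 1 i).eval t) (fun i t ht => by
      have h0 := (omega_pos ht).ne'
      have h2 := omega_sq (Ioo_subset_Icc_self ht)
      have h3 := (hasDerivAt_zpow (c - 2 * i) (omega t) (Or.inl h0)).comp t (hasDerivAt_omega ht)
      refine (h3.mul ((rseq c 1 i).hasDerivAt t)).congr_deriv ?_
      simp only [rseq, Polynomial.eval_sub, Polynomial.eval_mul, Polynomial.eval_C,
        Polynomial.eval_X, eval_E, ← h2, Function.comp_apply]
      have e1 : omega t ^ (c - 2 * (i : ℤ)) = omega t ^ (c - 2 * ((i + 1 : ℕ) : ℤ)) * omega t ^ 2 := by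
        rw [← zpow_natCast, ← zpow_add₀ h0]
        congr 1
        push_cast
        ring
      have e2 : omega t ^ (c - 2 * (i : ℤ) - 1) = omega t ^ (c - 2 * ((i + 1 : ℕ) : ℤ)) * omega t := by
        rw [← zpow_add_one₀ h0]
        congr 1
        push_cast
        ring
      rw [e1, e2]
      push_cast
      field_simp
      ring) k
  simpa [rseq] using h

/-! ### The spaces `H` are contained in the spaces `X` -/

theorem continuousOn_inv_omega_pow (N : ℕ) :
    ContinuousOn (fun t => (omega t ^ N)⁻¹) (Ioo (-1) 1) :=
  (continuous_omega.pow N).continuousOn.inv₀ fun _ ht => pow_ne_zero _ (omega_pos ht).ne'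

theorem locallyIntegrableOn_inv_omega_pow_mul (N : ℕ) (u : L2) :
    LocallyIntegrableOn (fun t => (omega t ^ N)⁻¹ * u t) (Ioo (-1) 1) := by
  have hu : IntegrableOn u (Ioo (-1) 1) := (Lp.memLp u).integrable (by norm_num)
  exact hu.locallyIntegrableOn.continuousOn_mul (continuousOn_inv_omega_pow N)
    isOpen_Ioo.isLocallyClosed

/-- `ω⁻ᴺ ψ` as an element of `L²(-1, 1)`, for a test function `ψ`. -/
def testL2 (N : ℕ) {ψ : ℝ → ℝ} (h : IsTest ψ) : L2 :=
  (memLp_of_continuous (h.continuous_mul (continuousOn_inv_omega_pow N)) 2).toLp _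

theorem inner_testL2 (N : ℕ) {ψ : ℝ → ℝ} (h : IsTest ψ) (u : L2) :
    inner ℝ (testL2 N h) u = ∫ t in Ioo (-1 : ℝ) 1, ((omega t ^ N)⁻¹ * u t) * ψ t := by
  rw [testL2, inner_eq_integral]
  apply integral_congr_ae
  filter_upwards with t
  ring

theorem inner_testL2_wpoly (N : ℕ) {ψ : ℝ → ℝ} (h : IsTest ψ) (p : ℝ[X]) :
    inner ℝ (testL2 N h) (wpoly N p) = ∫ t in Ioo (-1 : ℝ) 1, p.eval t * ψ t := by
  rw [inner_testL2]
  apply integral_congr_ae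
  filter_upwards [coeFn_wpoly N p, ae_mem_Ioo] with t ht ht1
  rw [ht, inv_mul_cancel_left₀ (pow_ne_zero _ (omega_pos ht1).ne')]

theorem summable_kap_smul {m k : ℕ} {u : L2} (hu : u ∈ H m k) :
    Summable fun j => (coeff (m + j) m u * kap (m + j) m k) • wpoly (m + k) (q (m + j) (m + k)) := by
  have hu' : Summable fun j : ℕ => (2 * ((m + j : ℕ) : ℝ) + 1) ^ (2 * k) * coeff (m + j) m u ^ 2 :=
    hu
  rw [summable_iff_vanishing_norm] at hu' ⊢
  intro ε hε
  obtain ⟨s, hs⟩ := hu' (ε ^ 2) (by positivity)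
  refine ⟨s, fun t ht => ?_⟩
  have h1 := (le_abs_self _).trans_lt (hs t ht)
  refine lt_of_pow_lt_pow_left₀ 2 hε.le (lt_of_le_of_lt ?_ h1)
  refine (norm_sum_smul_q_sq_le _ _ _ _).trans (Finset.sum_le_sum fun j _ => ?_)
  rw [mul_pow, mul_comm]
  exact mul_le_mul_of_nonneg_right (kap_sq_le _ _ _) (sq_nonneg _)

/-- The expansion of $u$, differentiated term by term with weight $\omega^{m+k}$, converges in $L^2$
to some $w$. Against a fixed test function both sides of the weak derivative identity pass to the
limit. -/
theorem H_subset_X (m k : ℕ) : H m k ⊆ X m k := by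
  intro u hu
  obtain ⟨w, hw⟩ := summable_kap_smul hu
  refine ⟨fun t => (omega t ^ (m + k))⁻¹ * w t, ⟨locallyIntegrableOn_inv_omega_pow_mul m u,
    locallyIntegrableOn_inv_omega_pow_mul (m + k) w, fun ψ h1 h2 h3 => ?_⟩, ?_⟩
  · have h : IsTest ψ := ⟨h1, h2, h3⟩
    rw [← inner_testL2 m (h.iteratedDeriv k), ← inner_testL2 (m + k) h]
    have t1 := (tendsto_const_nhds (x := testL2 m (h.iteratedDeriv k))).inner (𝕜 := ℝ)
      (tendsto_sum_coeff m u)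
    have t2 := ((tendsto_const_nhds (x := testL2 (m + k) h)).inner (𝕜 := ℝ)
      hw.tendsto_sum_nat).const_mul ((-1) ^ k)
    refine tendsto_nhds_unique t1 (t2.congr fun N => ?_)
    rw [← wpoly_iterate_derivative_sum, inner_testL2_wpoly, inner_testL2_wpoly]
    exact ((isWeakDeriv_polynomial k _).2.2 ψ h1 h2 h3).symm
  · refine (Lp.memLp w).ae_eq ?_
    filter_upwards [ae_mem_Ioo] with t ht
    rw [mul_inv_cancel_left₀ (pow_ne_zero _ (omega_pos ht).ne')]

/-! ### Powers of `ω` -/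

theorem coeFn_omegaPow (m : ℕ) : (omegaPow m : ℝ → ℝ) =ᵐ[μI] fun t => omega t ^ m :=
  MemLp.coeFn_toLp _

theorem omegaPow_eq_wpoly (m : ℕ) : omegaPow m = wpoly m 1 := by
  apply MemLp.toLp_congr
  filter_upwards with t
  simp

/-- Since `q m m` is a nonzero constant, $\omega^m$ is proportional to a basis vector and only the
term $j=0$ survives. -/
theorem omegaPow_mem_H (m k : ℕ) : omegaPow m ∈ H m k := by
  refine (hasSum_single (0 : ℕ) fun j hj => ?_).summable
  have h1 : coeff (m + j) m (wpoly m (q m m)) = 0 := by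
    rw [coeff_eq_inner, inner_wpoly_q_of_ne (by omega)]
  rw [q_self, ← mul_one (Polynomial.C _), wpoly_C_mul, coeff_eq_inner, inner_smul_right,
    ← coeff_eq_inner] at h1
  have h2 : coeff (m + j) m (wpoly m 1) = 0 := by
    refine (mul_eq_zero.mp h1).resolve_left ?_
    have := cst_pos m m
    positivity
  rw [omegaPow_eq_wpoly, h2]
  simp

theorem omegaPow_add_two_mul_mem_X (m j k : ℕ) : omegaPow (m + 2 * j) ∈ X m k := by
  refine ⟨_, (isWeakDeriv_polynomial k (E ^ j)).congr_left ?_,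
    memLp_of_continuous (continuous_omega_mul _ _) 2⟩
  filter_upwards [coeFn_omegaPow (m + 2 * j), ae_mem_Ioo] with t ht ht1
  rw [ht, pow_add, inv_mul_cancel_left₀ (pow_ne_zero _ (omega_pos ht1).ne'), pow_mul,
    omega_sq (Ioo_subset_Icc_self ht1)]
  simp

theorem isWeakDeriv_omegaPow (m m' k : ℕ) :
    IsWeakDeriv k (fun t => (omega t ^ m)⁻¹ * omegaPow m' t)
      (fun t => omega t ^ ((m' - m : ℤ) - 2 * k) * (rseq ((m' - m : ℤ) : ℝ) 1 k).eval t) := by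
  refine (isWeakDeriv_omega_zpow k (m' - m : ℤ)).congr_left ?_
  filter_upwards [coeFn_omegaPow m', ae_mem_Ioo] with t ht ht1
  rw [ht, zpow_sub₀ (omega_pos ht1).ne', zpow_natCast, zpow_natCast, div_eq_inv_mul]

theorem omega_pow_mul_zpow (m m' k : ℕ) {t : ℝ} (ht : t ∈ Ioo (-1 : ℝ) 1) :
    omega t ^ (m + k) * omega t ^ ((m' - m : ℤ) - 2 * k) = omega t ^ (m' - k : ℤ) := by
  rw [← zpow_natCast, ← zpow_add₀ (omega_pos ht).ne']
  congr 1
  push_cast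
  ring

theorem omegaPow_self_mem_X (m k : ℕ) : omegaPow k ∈ X m k := by
  refine ⟨_, isWeakDeriv_omegaPow m k k, ?_⟩
  refine (memLp_of_continuous (rseq ((k - m : ℤ) : ℝ) 1 k).continuous 2).ae_eq ?_
  filter_upwards [ae_mem_Ioo] with t ht
  rw [← mul_assoc, omega_pow_mul_zpow m k k ht, sub_self, zpow_zero, one_mul]

/-- As $E(1)=0$, each step of the recursion multiplies the value at $1$ by $-(c-2i)$. -/
theorem eval_one_rseq_ne_zero {c : ℝ} {k : ℕ} (h : ∀ i : ℕ, i < k → c ≠ 2 * i) :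
    (rseq c 1 k).eval 1 ≠ 0 := by
  induction k with
  | zero => simp [rseq]
  | succ k ih =>
    have h1 := ih fun i hi => h i (by omega)
    have h2 := sub_ne_zero.mpr (h k (by omega))
    simp [rseq, h1, h2]

/-- Near $1$ the square dominates a positive multiple of $1/(1-t)$, because
$\omega^{2d}\ge1/(1-t^2)$ for $d\le-1$; the latter is not integrable up to $1$. -/
theorem not_memLp_omega_zpow_mul {d : ℤ} (hd : d < 0) {p : ℝ[X]} (hp : p.eval 1 ≠ 0) :
    ¬ MemLp (fun t => omega t ^ d * p.eval t) 2 μI := by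
  intro h
  have h1 : Integrable (fun t => (omega t ^ d * p.eval t) ^ 2) μI := h.integrable_sq
  set δ := p.eval 1 ^ 2 / 2 with hδ
  have hδ0 : 0 < δ := by positivity
  have h2 : ∀ᶠ t in nhds (1 : ℝ), δ < p.eval t ^ 2 :=
    ((p.continuous.pow 2).tendsto 1).eventually_const_lt (by
      have : 0 < p.eval 1 ^ 2 := by positivity
      rw [hδ]
      exact half_lt_self this)
  obtain ⟨ε, hε, hball⟩ := Metric.eventually_nhds_iff_ball.mp h2
  set a := max 0 (1 - ε) with ha
  have ha0 : 0 ≤ a := le_max_left _ _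
  have ha1 : a < 1 := max_lt one_pos (by linarith)
  have h3 : IntervalIntegrable (fun t : ℝ => (t - 1)⁻¹) volume a 1 := by
    rw [intervalIntegrable_iff_integrableOn_Ioo_of_le ha1.le]
    have h4 : IntegrableOn (fun t => δ⁻¹ * (2 * (omega t ^ d * p.eval t) ^ 2)) (Ioo a 1) :=
      (((IntegrableOn.mono_set h1 (Ioo_subset_Ioo_left (by linarith))).const_mul 2).const_mul δ⁻¹)
    refine Integrable.mono' h4 (by fun_prop) ?_
    filter_upwards [ae_restrict_mem measurableSet_Ioo] with t ht
    have ht1 : t ∈ Ioo (-1 : ℝ) 1 := ⟨by linarith [ht.1], ht.2⟩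
    have ht2 : δ < p.eval t ^ 2 := hball t (by
      rw [Metric.mem_ball, Real.dist_eq, abs_sub_lt_iff]
      have := (le_max_right 0 (1 - ε)).trans_lt ht.1
      constructor <;> linarith [ht.2])
    have h5 : (1 - t ^ 2)⁻¹ ≤ (omega t ^ d) ^ 2 := by
      rw [← omega_sq (Ioo_subset_Icc_self ht1), ← inv_pow]
      have : (omega t)⁻¹ ≤ omega t ^ d := by
        rw [← zpow_neg_one]
        exact zpow_le_zpow_right_of_le_one₀ (omega_pos ht1) (omega_le_one t) (by omega)
      have h0 := inv_nonneg.mpr (omega_nonneg t)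
      gcongr
    have h6 : (1 - t)⁻¹ ≤ 2 * (1 - t ^ 2)⁻¹ := by
      have : 0 < 1 - t := by linarith [ht.2]
      have : 0 < 1 + t := by linarith [ht1.1]
      rw [show 1 - t ^ 2 = (1 - t) * (1 + t) by ring, mul_inv, mul_comm (1 - t)⁻¹,
        ← mul_assoc]
      refine le_mul_of_one_le_left (by positivity) ?_
      rw [← div_eq_mul_inv, one_le_div (by positivity)]
      linarith [ht.2]
    rw [Real.norm_eq_abs, abs_inv, abs_sub_comm, abs_of_pos (by linarith [ht.2])]
    rw [mul_pow, inv_mul_eq_div, le_div_iff₀ hδ0]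
    have h7 : 0 ≤ (1 - t)⁻¹ := inv_nonneg.mpr (by linarith [ht.2])
    calc (1 - t)⁻¹ * δ ≤ (2 * (omega t ^ d) ^ 2) * p.eval t ^ 2 :=
          mul_le_mul (by linarith) ht2.le hδ0.le (by positivity)
      _ = _ := by ring
  rw [intervalIntegrable_sub_inv_iff] at h3
  rcases h3 with h3 | h3
  · exact ha1.ne h3
  · exact h3 right_mem_uIcc

theorem omegaPow_mem_X_iff {k m m' : ℕ} (hm' : m' ≤ k) :
    omegaPow m' ∈ X m k ↔ m' = k ∨ ∃ j : ℕ, m' = m + 2 * j := by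
  constructor
  · rintro ⟨g, hg, hL⟩
    by_contra! hne
    refine not_memLp_omega_zpow_mul (d := (m' : ℤ) - k) (by have := hne.1; omega)
      (p := rseq ((m' - m : ℤ) : ℝ) 1 k) (eval_one_rseq_ne_zero fun i _ h => ?_) (hL.ae_eq ?_)
    · have h' : (m' - m : ℤ) = 2 * i := by exact_mod_cast h
      exact hne.2 i (by omega)
    · filter_upwards [hg.ae_eq (isWeakDeriv_omegaPow m m' k), ae_mem_Ioo] with t ht ht1
      rw [ht, ← mul_assoc, omega_pow_mul_zpow m m' k ht1]
  · rintro (rfl | ⟨j, rfl⟩)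
    · exact omegaPow_self_mem_X m m'
    · exact omegaPow_add_two_mul_mem_X m j k

theorem H_subset_iff {k m m' : ℕ} (hm' : m' ≤ k) :
    H m' k ⊆ H m k ↔ m' = k ∨ ∃ j : ℕ, m' = m + 2 * j := by
  constructor
  · intro h
    exact (omegaPow_mem_X_iff hm').mp (H_subset_X m k (h (omegaPow_mem_H m' k)))
  · rintro (rfl | ⟨j, rfl⟩)
    · exact H_self_subset m m'
    · exact H_add_two_mul_subset hm'

end LegendreScale

end

theorem mainTheorem9 (k m m' : ℕ) (hm : m ≤ k) (hm' : m' ≤ k) :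
    (LegendreScale.H m' k ⊆ LegendreScale.H m k ↔ m' = k ∨ ∃ j : ℕ, m' = m + 2 * j) ∧
    (LegendreScale.H m' k ⊂ LegendreScale.H m k ↔
      m' ≠ m ∧ (m' = k ∨ ∃ j : ℕ, m' = m + 2 * j)) ∧
    (LegendreScale.omegaPow m' ∈ LegendreScale.X m k ↔ m' = k ∨ ∃ j : ℕ, m' = m + 2 * j) := by
  refine ⟨LegendreScale.H_subset_iff hm', ?_, LegendreScale.omegaPow_mem_X_iff hm'⟩
  rw [Set.ssubset_def, LegendreScale.H_subset_iff hm', LegendreScale.H_subset_iff hm]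
  constructor
  · rintro ⟨h1, h2⟩
    refine ⟨fun h => h2 (Or.inr ⟨0, by omega⟩), h1⟩
  · rintro ⟨h1, h2⟩
    refine ⟨h2, ?_⟩
    -- The criterion is antisymmetric for indices at most $k$: both inclusions together would force
    -- $m=m'$.
    rintro (h3 | ⟨j, h3⟩) <;> rcases h2 with h2 | ⟨i, h2⟩ <;> omega
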